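/- **Conventions.** For $f:\mathbb R^n\to[-\infty,\infty]$ let $\mathrm{dom}(f)=\{x: f(x)<\infty\}$ and $f^*(y)=\sup_{x}\langle y,x\rangle-f(x)$; $f$ is proper if $f>-\infty$ and $\mathrm{dom}(f)\neq\emptyset$. For proper, convex, lower semicontinuous $f$, $\lambda f(x/\lambda)$ denotes, for $\lambda\ge0$, the perspective function, whose value at $\lambda=0$ is $\sup_{y\in\mathrm{dom}(f^*)}\langle y,x\rangle$. Perspectives of the form $q\,h(\hat z+\xi/q)$ and $q\,h(\alpha/q,\hat z+\xi/q)$ are those of $x\mapsto h(\hat z+x)$ and $(a,x)\mapsto h(a,\hat z+x)$. A Slater point of $\{x: h_n(x)\le0\ \forall n\}$ is a point $x$ of this set with $x\in\mathrm{ri}(\mathrm{dom}(h_n))$ for all $n$ and $h_n(x)<0$ for every $n$ such that $h_n$ is not (finite) affine. $[n]=\{1,\dots,n\}$. **Setting.** Let $\varepsilon>0$, $\mathcal Z=\{z\in\mathbb R^d: f_k(z)\le 0\ \forall k\in[K]\}$ and $\Theta=\{\theta\in\mathbb R^m: g_l(\theta)\le0\ \forall l\in[L]\}$ with all $f_k,g_l$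 proper, convex and lower semicontinuous. Let $\hat{\mathbb P}=\sum_{j\in[J]}p_j\delta_{\hat z_j}$ with $p_j>0$, $\sum_jp_j=1$, $\hat z_j\in\mathcal Z$. Let the cost $c(z,\hat z)\in[0,\infty]$ be lower semicontinuous in $(z,\hat z)$ and convex in $z$, with $c(z,\hat z)=0$ if and only if $z=\hat z$ for $z,\hat z\in\mathcal Z$ (a cost given only on $\mathcal Z\times\mathcal Z$ is extended by $\infty$). Let $\ell(\theta,z)=\max_{i\in[I]}\ell_i(\theta,z)$, $I\ge1$, where each $\ell_i:\mathbb R^m\times\mathbb R^d\to\mathbb R$ is convex in $\theta$ and concave in $z$. Put $d_c(\mathbb Q,\hat{\mathbb P})=\inf_\pi\mathbb E_\pi[c(Z,\hat Z)]$ over all couplings $\pi$ of $\mathbb Q$ and $\hat{\mathbb P}$, let $\mathbb B$ be the set of all probability distributions $\mathbb Q$ on $\mathcal Z$ with $d_c(\mathbb Q,\hat{\mathbb P})\le\varepsilon$, and consider the primal and dual DRO problems $$\text{(P)}\ \inf_{\theta\in\Theta}\sup_{\mathbb Q\in\mathbb B}\mathbb E_{\mathbb Q}[\ell(\theta,Z)],\qquad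 \text{(D)}\ \sup_{\mathbb Q\in\mathbb B}\inf_{\theta\in\Theta}\mathbb E_{\mathbb Q}[\ell(\theta,Z)].$$ **Assumptions.** (a) For all $\mathbb Q\in\mathbb B$ and $\bar\theta\in\Theta$ there is a neighborhood $\mathcal U$ of $\bar\theta$ in $\Theta$ such that the functions $-\min\{0,\ell(\theta,\cdot)\}$, $\theta\in\mathcal U$, are uniformly $\mathbb Q$-integrable. (b) $\sup_{\mathbb Q\in\mathbb B}\mathbb E_{\mathbb Q}[\ell(\theta,Z)]<\infty$ for some $\theta\in\Theta$. (c) Every $\hat z_j$ lies in $\mathrm{ri}(\mathrm{dom}(c(\cdot,\hat z_j)))$ and is a Slater point of $\mathcal Z$, and $\Theta$ has a Slater point. (d) At least one of the following holds: for some $\mathbb Q\in\mathbb B$ all sets $\{\theta\in\Theta:\mathbb E_{\mathbb Q}[\ell(\theta,Z)]\le r\}$, $r\in\mathbb R$, are compact; or $\mathcal Z$ is compact; or $c$ grows superlinearly, that is, $c(z,\hat z)/\|z\|\to\infty$ as $\|z\|\to\infty$, $z\in\mathcal Z$, for each $\hat z\in\mathcal Z$. **Finite convex programs.** Write $(-\ell_i)^{*2}$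 for the conjugate of $-\ell_i$ in $z$, $\ell_i^{*1}$ for the conjugate of $\ell_i$ in $\theta$, and $c^{*1}$ for the conjugate of $c$ in its first argument; indices range over $i\in[I]$, $j\in[J]$, $k\in[K]$, $l\in[L]$. (FP) minimizes $\lambda\varepsilon+\sum_jp_js_j$ over $\theta\in\Theta$, $\lambda,\tau_{ijk}\in\mathbb R_+$, $s_j\in\mathbb R$, $\zeta^\ell_{ij},\zeta^c_{ij},\zeta^f_{ijk}\in\mathbb R^d$ subject to, for all $i,j$, $$(-\ell_i)^{*2}(\theta,\zeta^\ell_{ij})+\lambda c^{*1}(\zeta^c_{ij}/\lambda,\hat z_j)+\sum_k\tau_{ijk}f_k^*(\zeta^f_{ijk}/\tau_{ijk})\le s_j,\qquad \zeta^\ell_{ij}+\zeta^c_{ij}+\sum_k\zeta^f_{ijk}=0 .$$ (FD) maximizes $-\sum_{i,j}q_{ij}\ell_i^{*1}(\alpha_{ij}/q_{ij},\hat z_j+\xi_{ij}/q_{ij})-\sum_l\nu_lg_l^*(\beta_l/\nu_l)$ over $q_{ij},\nu_l\in\mathbb R_+$, $\xi_{ij}\in\mathbb R^d$, $\alpha_{ij},\beta_l\in\mathbb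 R^m$ subject to $$q_{ij}f_k(\hat z_j+\xi_{ij}/q_{ij})\le0\ \ \forall i,j,k,\quad \sum_iq_{ij}=p_j\ \ \forall j,\quad \sum_{i,j}\alpha_{ij}+\sum_l\beta_l=0,\quad \sum_{i,j}q_{ij}\,c(\hat z_j+\xi_{ij}/q_{ij},\hat z_j)\le\varepsilon .$$ **Theorem (Computing Nash equilibria).** Under these assumptions the optimal values of (P) and (D) coincide, and the following hold. (i) If $(\theta^\star,\lambda^\star,s^\star,\zeta^{\ell\star},\zeta^{c\star},\tau^\star,\zeta^{f\star})$ solves (FP), then $\theta^\star$ solves (P). (ii) If $(q^\star,\xi^\star,\alpha^\star,\nu^\star,\beta^\star)$ solves (FD) and $\mathcal I_j^\infty=\{i\in[I]:q^\star_{ij}=0,\ \xi^\star_{ij}\ne0\}$ is empty for every $j\in[J]$, then the discrete distribution $$\mathbb Q^\star=\sum_{j\in[J]}\ \sum_{i\in[I]:\,q^\star_{ij}>0}q^\star_{ij}\,\delta_{\hat z_j+\xi^\star_{ij}/q^\star_{ij}}$$ solves (D). -/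

import Mathlib

open MeasureTheory Filter Topology Set
open scoped RealInnerProductSpace

namespace DRO

/-! Convex analysis of extended real-valued functions. -/

section ConvexAnalysis

variable {V : Type*} [NormedAddCommGroup V] [InnerProductSpace ℝ V]

/-- The (effective) domain of an extended real-valued function. -/
def dom (f : V → EReal) : Set V := {x | f x < ⊤}

/-- `f` never takes the value `-∞` and is finite somewhere. -/
def IsProper (f : V → EReal) : Prop := (∀ x, ⊥ < f x) ∧ (dom f).Nonempty

/-- Convexity of an extended real-valued function: its epigraph in `V × ℝ` is convex. -/
def IsConvexFun (f : V → EReal) : Prop := Convex ℝ {p : V × ℝ | f p.1 ≤ (p.2 : EReal)}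

/-- Proper, convex and lower semicontinuous. -/
def IsPCL (f : V → EReal) : Prop := IsProper f ∧ IsConvexFun f ∧ LowerSemicontinuous f

/-- The convex conjugate `f*(y) = sup_x ⟨y, x⟩ - f x`. -/
noncomputable def conj (f : V → EReal) (y : V) : EReal :=
  ⨆ x : V, ((⟪y, x⟫ : ℝ) : EReal) - f x

/-- The support function of `C`, that is, the conjugate of the indicator function of `C`. -/
noncomputable def supportFun (C : Set V) (x : V) : EReal :=
  ⨆ y ∈ C, ((⟪y, x⟫ : ℝ) : EReal)

/-- The perspective `t f(x / t)` of a proper, convex and lower semicontinuous `f`. For `t = 0` it is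
the support function of `dom f*` (and it is only used for `t ≥ 0`). -/
noncomputable def persp (f : V → EReal) (x : V) (t : ℝ) : EReal :=
  open Classical in
  if 0 < t then (t : EReal) * f (t⁻¹ • x) else supportFun (dom (conj f)) x

/-- `f` is a (finite) affine function. -/
def IsAffineFun (f : V → EReal) : Prop :=
  ∃ (a : V) (b : ℝ), ∀ x, f x = ((⟪a, x⟫ + b : ℝ) : EReal)

/-- The set `{x : h_n x ≤ 0 for all n}`. -/
def feasSet {N : ℕ} (h : Fin N → V → EReal) : Set V := {x | ∀ n, h n x ≤ 0}

/-- Slater point of the set `{x : h_n x ≤ 0 for all n}`. -/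
def IsSlaterPoint {N : ℕ} (h : Fin N → V → EReal) (x : V) : Prop :=
  x ∈ feasSet h ∧ (∀ n, x ∈ intrinsicInterior ℝ (dom (h n))) ∧
    ∀ n, ¬ IsAffineFun (h n) → h n x < 0

end ConvexAnalysis

/-! Expectations and optimal transport. -/

/-- The extended expectation `E[f⁺] - E[f⁻]` (equal to `-∞` if both parts are infinite). -/
noncomputable def expect {X : Type*} [MeasurableSpace X] (Q : Measure X) (f : X → ℝ) : EReal :=
  ((∫⁻ z, ENNReal.ofReal (f z) ∂Q : ENNReal) : EReal)
    - ((∫⁻ z, ENNReal.ofReal (-f z) ∂Q : ENNReal) : EReal)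

/-- Couplings of `Q` and `R`. -/
def couplings {X : Type*} [MeasurableSpace X] (Q R : Measure X) : Set (Measure (X × X)) :=
  {π | π.map Prod.fst = Q ∧ π.map Prod.snd = R}

/-- The optimal transport discrepancy with cost `c`. -/
noncomputable def otCost {X : Type*} [MeasurableSpace X] (c : X → X → ENNReal)
    (Q R : Measure X) : ENNReal :=
  ⨅ π ∈ couplings Q R, ∫⁻ w, c w.1 w.2 ∂π

/-- The space `ℝⁿ` with the Euclidean inner product. -/
abbrev Vec (n : ℕ) := EuclideanSpace ℝ (Fin n)

/-- The raw data of a distributionally robust optimization problem with discrete reference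
distribution, decisions in `ℝᵐ`, uncertain parameters in `ℝᵈ`, `I` loss pieces, `J` atoms and
`K`, `L` constraint functions for the support set and the feasible set. A transportation cost that
is given only on the (closed convex) support set is extended by `∞`. -/
structure Problem (m d I J K L : ℕ) where
  /-- radius of the ambiguity set -/
  eps : ℝ
  /-- probabilities of the atoms -/
  prob : Fin J → ℝ
  /-- atoms of the reference distribution -/
  atom : Fin J → Vec d
  /-- transportation cost `c(z, ẑ)` -/
  cost : Vec d → Vec d → ENNReal
  /-- the saddle functions `ℓ_i(θ, z)`, which are finite-valued -/
  piece : Fin I → Vec m → Vec d → ℝ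
  /-- constraint functions `f_k` of the support set -/
  f : Fin K → Vec d → EReal
  /-- constraint functions `g_l` of the feasible set -/
  g : Fin L → Vec m → EReal

/-- Decision variables of the finite primal program. -/
structure PrimalVars (m d I J K : ℕ) where
  θ : Vec m
  lam : ℝ
  s : Fin J → ℝ
  ζl : Fin I → Fin J → Vec d
  ζc : Fin I → Fin J → Vec d
  τ : Fin I → Fin J → Fin K → ℝ
  ζf : Fin I → Fin J → Fin K → Vec d

/-- Decision variables of the finite dual program. -/
structure DualVars (m d I J L : ℕ) where
  q : Fin I → Fin J → ℝ
  ξ : Fin I → Fin J → Vec d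
  α : Fin I → Fin J → Vec m
  ν : Fin L → ℝ
  β : Fin L → Vec m

namespace Problem

variable {m d I J K L : ℕ} (P : Problem m d I J K L)

/-- The support set. -/
def supp : Set (Vec d) := feasSet P.f

/-- The feasible set of the decision maker. -/
def feas : Set (Vec m) := feasSet P.g

/-- The loss function, the pointwise maximum of the saddle functions (used for `I ≥ 1`). -/
noncomputable def loss (θ : Vec m) (z : Vec d) : ℝ := ⨆ i, P.piece i θ z

/-- The transportation cost of moving mass from the atom `j` to `z`, as an extended real. -/
noncomputable def atomCost (j : Fin J) (z : Vec d) : EReal := (P.cost z (P.atom j) : EReal)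

/-- The reference distribution. -/
noncomputable def refDist : Measure (Vec d) :=
  ∑ j, ENNReal.ofReal (P.prob j) • Measure.dirac (P.atom j)

/-- The ambiguity set: probability distributions on the support set within transport discrepancy
`eps` of the reference distribution. -/
def ball : Set (Measure (Vec d)) :=
  {Q | IsProbabilityMeasure Q ∧ Q P.suppᶜ = 0 ∧ otCost P.cost Q P.refDist ≤ ENNReal.ofReal P.eps}

/-- The worst-case expected loss of the decision `θ`. -/
noncomputable def worstCase (θ : Vec m) : EReal := ⨆ Q ∈ P.ball, expect Q (P.loss θ)

/-- The smallest expected loss under the distribution `Q`. -/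
noncomputable def bestCase (Q : Measure (Vec d)) : EReal := ⨅ θ ∈ P.feas, expect Q (P.loss θ)

/-- The optimal value of the primal DRO problem. -/
noncomputable def primalValue : EReal := ⨅ θ ∈ P.feas, P.worstCase θ

/-- The optimal value of the dual DRO problem. -/
noncomputable def dualValue : EReal := ⨆ Q ∈ P.ball, P.bestCase Q

/-- `θ` is an optimal solution of the primal DRO problem. -/
def SolvesPrimalDRO (θ : Vec m) : Prop := θ ∈ P.feas ∧ ∀ θ' ∈ P.feas, P.worstCase θ ≤ P.worstCase θ'

/-- `Q` is an optimal solution of the dual DRO problem. -/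
def SolvesDualDRO (Q : Measure (Vec d)) : Prop :=
  Q ∈ P.ball ∧ ∀ Q' ∈ P.ball, P.bestCase Q' ≤ P.bestCase Q

/-! The assumptions. -/

/-- The negative parts of the loss are locally (in the decision) uniformly integrable with respect
to each distribution in the ambiguity set. -/
def LossNegPartUnifInt : Prop :=
  ∀ Q ∈ P.ball, ∀ θ₀ ∈ P.feas, ∃ U ∈ 𝓝[P.feas] θ₀,
    UniformIntegrable (fun (θ : U) (z : Vec d) => -(min 0 (P.loss θ z))) 1 Q

/-- Some decision has a worst-case expected loss below `+∞`. -/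
def WorstCaseFinite : Prop := ∃ θ ∈ P.feas, P.worstCase θ < ⊤

/-- The reference distribution is a discrete probability distribution on the support set. -/
def DiscreteReference : Prop :=
  (∀ j, 0 < P.prob j) ∧ ∑ j, P.prob j = 1 ∧ ∀ j, P.atom j ∈ P.supp

/-- Standing assumption on the cost: identity of indiscernibles on the support set. -/
def CostIndiscernible : Prop := ∀ z ∈ P.supp, ∀ z' ∈ P.supp, P.cost z z' = 0 ↔ z = z'

/-- The convexity conditions. Finite convex or concave functions on the whole of `ℝⁿ` are
continuous, so semicontinuity of the saddle functions need not be required separately. -/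
structure ConvexityConditions : Prop where
  cost_lsc : LowerSemicontinuous (fun w : Vec d × Vec d => P.cost w.1 w.2)
  cost_convex : ∀ z' ∈ P.supp, IsConvexFun (fun z => (P.cost z z' : EReal))
  piece_convex : ∀ i z, ConvexOn ℝ univ (fun θ => P.piece i θ z)
  piece_concave : ∀ i θ, ConcaveOn ℝ univ (fun z => P.piece i θ z)
  supp_fun : ∀ k, IsPCL (P.f k)
  feas_fun : ∀ l, IsPCL (P.g l)

/-- The Slater conditions. -/
def SlaterConditions : Prop :=
  (∀ j, P.atom j ∈ intrinsicInterior ℝ (dom (P.atomCost j)) ∧ IsSlaterPoint P.f (P.atom j)) ∧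
    ∃ θ, IsSlaterPoint P.g θ

/-- The expected loss is inf-compact under some distribution in the ambiguity set. -/
def InfCompact : Prop :=
  ∃ Q ∈ P.ball, ∀ r : ℝ, IsCompact {θ | θ ∈ P.feas ∧ expect Q (P.loss θ) ≤ (r : EReal)}

/-- `c(z, ẑ)` grows superlinearly with `z`, that is, `c(z, ẑ) / ‖z‖ → ∞` as `‖z‖ → ∞` within the
support set, for each fixed `ẑ`. -/
def SuperlinearCost : Prop :=
  ∀ z' ∈ P.supp, Tendsto (fun z => P.cost z z' / ENNReal.ofReal ‖z‖)
    (Bornology.cobounded (Vec d) ⊓ 𝓟 P.supp) (𝓝 ⊤)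

/-- At least one of three compactness or growth conditions holds. -/
def RegularityCondition : Prop := P.InfCompact ∨ IsCompact P.supp ∨ P.SuperlinearCost

/-! The finite convex programs. -/

/-- Feasibility in the finite primal program. -/
structure PrimalFeasible (x : PrimalVars m d I J K) : Prop where
  θ_mem : x.θ ∈ P.feas
  lam_nonneg : 0 ≤ x.lam
  τ_nonneg : ∀ i j k, 0 ≤ x.τ i j k
  epi : ∀ i j,
    conj (fun z => ((-P.piece i x.θ z : ℝ) : EReal)) (x.ζl i j)
      + persp (conj (P.atomCost j)) (x.ζc i j) x.lam
      + ∑ k, persp (conj (P.f k)) (x.ζf i j k) (x.τ i j k) ≤ (x.s j : EReal)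
  balance : ∀ i j, x.ζl i j + x.ζc i j + ∑ k, x.ζf i j k = 0

/-- Objective of the finite primal program. -/
def primalObj (x : PrimalVars m d I J K) : ℝ := x.lam * P.eps + ∑ j, P.prob j * x.s j

/-- Optimal solution of the finite primal (minimization) program. -/
def SolvesPrimalProgram (x : PrimalVars m d I J K) : Prop :=
  P.PrimalFeasible x ∧ ∀ y, P.PrimalFeasible y → P.primalObj x ≤ P.primalObj y

/-- The map `(a, x) ↦ ℓ_i^{*1}(a, ẑ_j + x)`, where the conjugate is taken in the decision. It is
jointly convex, and its perspective appears in the objective of the finite dual program. -/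
noncomputable def conjPiece (i : Fin I) (j : Fin J) (w : WithLp 2 (Vec m × Vec d)) : EReal :=
  conj (fun θ => (P.piece i θ (P.atom j + w.snd) : EReal)) w.fst

/-- Feasibility in the finite dual program. -/
structure DualFeasible (y : DualVars m d I J L) : Prop where
  q_nonneg : ∀ i j, 0 ≤ y.q i j
  ν_nonneg : ∀ l, 0 ≤ y.ν l
  supp : ∀ i j k, persp (fun x => P.f k (P.atom j + x)) (y.ξ i j) (y.q i j) ≤ 0
  mass : ∀ j, ∑ i, y.q i j = P.prob j
  balance : ∑ i, ∑ j, y.α i j + ∑ l, y.β l = 0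
  budget : ∑ i, ∑ j, persp (fun x => P.atomCost j (P.atom j + x)) (y.ξ i j) (y.q i j)
    ≤ (P.eps : EReal)

/-- Objective of the finite dual program. -/
noncomputable def dualObj (y : DualVars m d I J L) : EReal :=
  -(∑ i, ∑ j, persp (P.conjPiece i j) (WithLp.toLp 2 (y.α i j, y.ξ i j)) (y.q i j))
    - ∑ l, persp (conj (P.g l)) (y.β l) (y.ν l)

/-- Optimal solution of the finite dual (maximization) program. -/
def SolvesDualProgram (y : DualVars m d I J L) : Prop :=
  P.DualFeasible y ∧ ∀ y', P.DualFeasible y' → P.dualObj y' ≤ P.dualObj y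

/-- The index set of the pieces that send no mass from the atom `j` but have a nonzero direction. -/
def infIndices (y : DualVars m d I J L) (j : Fin J) : Set (Fin I) :=
  {i | y.q i j = 0 ∧ y.ξ i j ≠ 0}

/-- The discrete distribution with mass `q_ij` at `ẑ_j + ξ_ij / q_ij` for all `q_ij > 0`. -/
noncomputable def discreteDist (y : DualVars m d I J L) : Measure (Vec d) :=
  open Classical in
  ∑ j, ∑ i ∈ Finset.univ.filter (fun i => 0 < y.q i j),
    ENNReal.ofReal (y.q i j) • Measure.dirac (P.atom j + (y.q i j)⁻¹ • y.ξ i j)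

end Problem

end DRO

/-! Everything is reduced to finite transport plans: mass `q i j` leaves atom `j` for the point `z i
j` of the support set and is charged the loss of piece `i`. Two plans merge at barycenters;
convexity of the cost and concavity of the pieces ensure that the merged plan costs no more than the
mixture and loses at least as much, for every decision at once (`exists_plan_combo`). Plans thus act
like a convex set on which the loss is concave, while it is convex in the decision.

For a fixed decision, the supremum over the ambiguity set is the supremum over plans. A multiplier
`lam` for the budget and numbers `s j` with `ℓ_i ≤ s j + lam * c` bound every expectation in the
ball (`expect_le_of_mem_ball`). Conversely, a bound on all plans produces such multipliers
(`exists_multiplier_of_planLoss_le`), because leaving all mass in place is strictly within budget.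

The core is a minimax statement (`exists_plan_of_lt_primalValue`): each `r` below the primal value
is guaranteed by one plan against all feasible decisions. With an inf-compact expected loss,
compactness leaves finitely many plans, which a theorem of alternatives combines into one.
Otherwise, plans that defeat finite sets of decisions have a limit plan, because the compactness or
growth condition prevents mass from escaping with positive first moment. Equality of the two values
follows at once.

The finite programs come from Fenchel–Lagrange duality under the Slater condition
(`exists_dual_solution`), applied in `z` for each pair `(i, j)` for (FP) and in `θ` against a fixed
plan for (FD). Weak duality maps feasible points back: a point of (FP) bounds the worst case of its
decision, and a point of (FD) without infinite directions is a plan whose loss dominates the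
objective. Approximate attainment in one direction and weak duality in the other suffice, since
optimality of the given solution is assumed. -/

namespace DRO

/-! Lagrange multipliers for convex programs over a convex set in a real vector space. -/

section Lagrange

variable {X : Type*} [AddCommGroup X] [Module ℝ X]

/-- The weights proportional to `-h y` and `h x` make the interpolated value of `h` vanish; there
`v` is below `G`, hence below the chord of `G`. The result says that every slope required by an
infeasible point is below every slope allowed by a strictly feasible one, so a number between them
is a multiplier. -/
theorem slope_ineq {D : Set X} {G h : X → ℝ} (hG : ConvexOn ℝ D G) {v : ℝ} {x y : X} (hx : x ∈ D)
    (hy : y ∈ D) (hhx : 0 < h x) (hhy : h y < 0)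
    (hv : ∀ s t : ℝ, 0 ≤ s → 0 ≤ t → s + t = 1 → s * h x + t * h y = 0 → v ≤ G (s • x + t • y)) :
    (v - G x) / h x ≤ (G y - v) / (-h y) := by
  have hd : 0 < h x - h y := by linarith
  have hs : 0 ≤ -h y / (h x - h y) := div_nonneg (by linarith) hd.le
  have ht : 0 ≤ h x / (h x - h y) := div_nonneg hhx.le hd.le
  have hst : -h y / (h x - h y) + h x / (h x - h y) = 1 := by field_simp; ring
  have h1 := hv _ _ hs ht hst (by field_simp; ring)
  have h2 := hG.2 hx hy hs ht hst
  simp only [smul_eq_mul] at h2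
  have h3 : v * (h x - h y) ≤ -h y * G x + h x * G y := by
    have h4 := mul_le_mul_of_nonneg_right (h1.trans h2) hd.le
    have h5 : (-h y / (h x - h y) * G x + h x / (h x - h y) * G y) * (h x - h y)
        = -h y * G x + h x * G y := by field_simp
    linarith
  rw [div_le_div_iff₀ hhx (by linarith)]
  nlinarith

/-- Lagrange multiplier for one strictly feasible convex constraint. -/
theorem exists_multiplier_of_slater {D : Set X} {G h : X → ℝ} (hG : ConvexOn ℝ D G)
    (hh : ConvexOn ℝ D h) {x₀ : X} (hx₀ : x₀ ∈ D) (hs : h x₀ < 0) {v : ℝ}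
    (hv : ∀ x ∈ D, h x ≤ 0 → v ≤ G x) : ∃ τ : ℝ, 0 ≤ τ ∧ ∀ x ∈ D, v ≤ G x + τ * h x := by
  -- These are the lower bounds that points with `h > 0` impose on the multiplier; inserting `0`
  -- makes the supremum nonnegative.
  let A : Set ℝ := insert 0 ((fun x => (v - G x) / h x) '' {x | x ∈ D ∧ 0 < h x})
  have key : ∀ y ∈ D, h y < 0 → ∀ r ∈ A, r ≤ (G y - v) / (-h y) := by
    rintro y hy hhy r (rfl | ⟨x, ⟨hx, hhx⟩, rfl⟩)
    · exact div_nonneg (by linarith [hv y hy hhy.le]) (by linarith)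
    · refine slope_ineq hG hx hy hhx hhy fun s t hs ht hst h0 => hv _ (hG.1 hx hy hs ht hst) ?_
      have := hh.2 hx hy hs ht hst
      simp only [smul_eq_mul] at this
      linarith
  have hbdd : BddAbove A := ⟨_, key x₀ hx₀ hs⟩
  refine ⟨sSup A, le_csSup hbdd (mem_insert _ _), fun x hx => ?_⟩
  rcases lt_trichotomy (h x) 0 with h0 | h0 | h0
  · have := csSup_le ⟨0, mem_insert _ _⟩ (key x hx h0)
    rw [le_div_iff₀ (by linarith)] at this
    linarith
  · simpa [h0] using hv x hx h0.le
  · have := le_csSup hbdd (mem_insert_of_mem 0 (mem_image_of_mem _ (⟨hx, h0⟩ : x ∈ {x | x ∈ D ∧ 0 < h x})))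
    rw [div_le_iff₀ h0] at this
    linarith

theorem convexOn_affine (a : X →ᵃ[ℝ] ℝ) {D : Set X} (hD : Convex ℝ D) : ConvexOn ℝ D a := by
  refine ⟨hD, fun x _ y _ s t _ _ hst => ?_⟩
  rw [Convex.combo_affine_apply hst]

/-- Lagrange multiplier for one affine equality constraint. -/
theorem exists_multiplier_of_eq {D : Set X} {G : X → ℝ} (hG : ConvexOn ℝ D G)
    (a : X →ᵃ[ℝ] ℝ) {x₁ x₂ : X} (hx₁ : x₁ ∈ D) (h₁ : a x₁ < 0) (hx₂ : x₂ ∈ D) (h₂ : 0 < a x₂) {v : ℝ}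
    (hv : ∀ x ∈ D, a x = 0 → v ≤ G x) : ∃ μ : ℝ, ∀ x ∈ D, v ≤ G x + μ * a x := by
  let A : Set ℝ := (fun x => (v - G x) / a x) '' {x | x ∈ D ∧ 0 < a x}
  have hne : A.Nonempty := ⟨_, mem_image_of_mem _ ⟨hx₂, h₂⟩⟩
  have key : ∀ y ∈ D, a y < 0 → ∀ r ∈ A, r ≤ (G y - v) / (-a y) := by
    rintro y hy hhy r ⟨x, ⟨hx, hhx⟩, rfl⟩
    refine slope_ineq (h := a) hG hx hy hhx hhy fun s t hs ht hst h0 => hv _ (hG.1 hx hy hs ht hst) ?_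
    rw [Convex.combo_affine_apply hst]
    simpa using h0
  have hbdd : BddAbove A := ⟨_, key x₁ hx₁ h₁⟩
  refine ⟨sSup A, fun x hx => ?_⟩
  rcases lt_trichotomy (a x) 0 with h0 | h0 | h0
  · have := csSup_le hne (key x hx h0)
    rw [le_div_iff₀ (by linarith)] at this
    linarith
  · simpa [h0] using hv x hx h0
  · have := le_csSup hbdd (mem_image_of_mem _ (⟨hx, h0⟩ : x ∈ {x | x ∈ D ∧ 0 < a x}))
    rw [div_le_iff₀ h0] at this
    linarith

theorem convexOn_add_sum {ι : Type*} {D : Set X} {G : X → ℝ} (hG : ConvexOn ℝ D G) (s : Finset ι)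
    {h : ι → X → ℝ} (hh : ∀ k ∈ s, ConvexOn ℝ D (h k)) {τ : ι → ℝ} (hτ : ∀ k, 0 ≤ τ k) :
    ConvexOn ℝ D (fun x => G x + ∑ k ∈ s, τ k * h k x) := by
  classical
  induction s using Finset.induction_on with
  | empty => simpa using hG
  | insert k s hk ih =>
    have h1 := (ih fun k' hk' => hh k' (Finset.mem_insert_of_mem hk')).add
      ((hh k (Finset.mem_insert_self _ _)).smul (hτ k))
    refine h1.congr fun x _ => ?_
    simp only [Pi.add_apply, smul_eq_mul, Finset.sum_insert hk]
    ring

/-- Lagrange multipliers for strictly feasible convex constraints. -/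
theorem exists_multipliers_of_slater {ι : Type*} {D : Set X} {h : ι → X → ℝ}
    {x₀ : X} (hx₀ : x₀ ∈ D) {v : ℝ} (s : Finset ι) :
    ∀ {G : X → ℝ}, ConvexOn ℝ D G → (∀ k ∈ s, ConvexOn ℝ D (h k)) → (∀ k ∈ s, h k x₀ < 0) →
    (∀ x ∈ D, (∀ k ∈ s, h k x ≤ 0) → v ≤ G x) →
    ∃ τ : ι → ℝ, (∀ k, 0 ≤ τ k) ∧ ∀ x ∈ D, v ≤ G x + ∑ k ∈ s, τ k * h k x := by
  classical
  induction s using Finset.induction_on with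
  | empty => intro G _ _ _ hv; exact ⟨0, fun _ => le_rfl, fun x hx => by simpa using hv x hx⟩
  | insert k s hk ih =>
    intro G hG hh hs hv
    have hD' : Convex ℝ {x ∈ D | ∀ k ∈ s, h k x ≤ 0} := by
      rintro x ⟨hx, hx'⟩ y ⟨hy, hy'⟩ a b ha hb hab
      refine ⟨hG.1 hx hy ha hb hab, fun k hk => ?_⟩
      have := (hh k (Finset.mem_insert_of_mem hk)).2 hx hy ha hb hab
      simp only [smul_eq_mul] at this
      nlinarith [hx' k hk, hy' k hk]
    have hsub : {x ∈ D | ∀ k ∈ s, h k x ≤ 0} ⊆ D := fun x hx => hx.1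
    -- The constraint `k` is priced over the set where the others hold; its term then joins the
    -- objective and the others are priced over all of `D`.
    obtain ⟨t, ht, ht'⟩ := exists_multiplier_of_slater (hG.subset hsub hD')
      ((hh k (Finset.mem_insert_self _ _)).subset hsub hD') (x₀ := x₀)
      ⟨hx₀, fun k hk => (hs k (Finset.mem_insert_of_mem hk)).le⟩ (hs k (Finset.mem_insert_self _ _))
      (v := v) (fun x hx hx' => hv x hx.1 (by
        intro k' hk'
        rcases Finset.mem_insert.1 hk' with rfl | hk'
        exacts [hx', hx.2 k' hk']))
    obtain ⟨τ, hτ, hτ'⟩ := ih (G := fun x => G x + t * h k x)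
      (hG.add ((hh k (Finset.mem_insert_self _ _)).smul ht))
      (fun k hk => hh k (Finset.mem_insert_of_mem hk))
      (fun k hk => hs k (Finset.mem_insert_of_mem hk)) (fun x hx hx' => ht' x ⟨hx, hx'⟩)
    refine ⟨Function.update τ k t, fun k' => ?_, fun x hx => ?_⟩
    · by_cases hkk : k' = k
      · subst hkk; simpa using ht
      · simpa [hkk] using hτ k'
    · have := hτ' x hx
      rw [Finset.sum_insert hk, Function.update_self, Finset.sum_congr rfl (g := fun k => τ k * h k x)]
      · linarith
      · intro k' hk'
        rw [Function.update_of_ne (by rintro rfl; exact hk hk')]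

/-- `x₀` belongs to the algebraic relative interior of the convex set `D`. -/
def AlgRelInt (D : Set X) (x₀ : X) : Prop :=
  x₀ ∈ D ∧ ∀ x ∈ D, ∃ t : ℝ, 0 < t ∧ x₀ + t • (x₀ - x) ∈ D

theorem affine_reflect (a : X →ᵃ[ℝ] ℝ) (x₀ x : X) (t : ℝ) :
    a (x₀ + t • (x₀ - x)) = a x₀ + t * (a x₀ - a x) := by
  have h1 : a (x₀ + t • (x₀ - x)) = a.linear (t • (x₀ - x)) + a x₀ := by
    rw [add_comm]; exact a.map_vadd x₀ (t • (x₀ - x))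
  have h2 : a.linear (x₀ - x) = a x₀ - a x := a.linearMap_vsub x₀ x
  rw [h1, map_smul, h2, smul_eq_mul]; ring

/-- An affine function that attains its minimum at a relative interior point is constant: any
increase towards `x` would be a decrease at the reflected point. -/
theorem AlgRelInt.eq_zero_of_nonneg {D : Set X} {x₀ : X} (h : AlgRelInt D x₀) (b : X →ᵃ[ℝ] ℝ)
    (hb : ∀ x ∈ D, 0 ≤ b x) (h0 : b x₀ ≤ 0) : ∀ x ∈ D, b x = 0 := by
  intro x hx
  obtain ⟨t, ht, hx'⟩ := h.2 x hx
  have h1 := hb _ hx'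
  rw [affine_reflect] at h1
  have h2 := hb x hx
  have h3 := hb x₀ h.1
  nlinarith

theorem AlgRelInt.inter_affine {D : Set X} {x₀ : X} (h : AlgRelInt D x₀) (a : X →ᵃ[ℝ] ℝ)
    (h0 : a x₀ = 0) : AlgRelInt {x ∈ D | a x = 0} x₀ := by
  refine ⟨⟨h.1, h0⟩, fun x hx => ?_⟩
  obtain ⟨t, ht, hx'⟩ := h.2 x hx.1
  exact ⟨t, ht, hx', by rw [affine_reflect, h0, hx.2]; simp⟩

/-- Lagrange multipliers for affine constraints at a feasible point of the relative interior. -/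
theorem exists_multipliers_of_affine {ι : Type*} (a : ι → X →ᵃ[ℝ] ℝ) {x₀ : X} (s : Finset ι)
    (hs : ∀ k ∈ s, a k x₀ ≤ 0) :
    ∀ {D : Set X} {G : X → ℝ} {v : ℝ}, AlgRelInt D x₀ → ConvexOn ℝ D G →
    (∀ x ∈ D, (∀ k ∈ s, a k x ≤ 0) → v ≤ G x) →
    ∃ τ : ι → ℝ, (∀ k, 0 ≤ τ k) ∧ ∀ x ∈ D, v ≤ G x + ∑ k ∈ s, τ k * a k x := by
  classical
  induction s using Finset.induction_on with
  | empty => intro D G v _ _ hv; exact ⟨0, fun _ => le_rfl, fun x hx => by simpa using hv x hx⟩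
  | insert k s hk ih =>
    intro D G v hri hG hv
    have hs' : ∀ k ∈ s, a k x₀ ≤ 0 := fun k hk => hs k (Finset.mem_insert_of_mem hk)
    have hsk : a k x₀ ≤ 0 := hs k (Finset.mem_insert_self _ _)
    replace ih := @ih hs'
    have hupd : ∀ (τ : ι → ℝ) (t : ℝ) (x : X),
        ∑ k' ∈ insert k s, Function.update τ k t k' * a k' x
          = t * a k x + ∑ k' ∈ s, τ k' * a k' x := by
      intro τ t x
      rw [Finset.sum_insert hk, Function.update_self,
        Finset.sum_congr rfl (g := fun k => τ k * a k x)]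
      intro k' hk'
      rw [Function.update_of_ne (by rintro rfl; exact hk hk')]
    have hupd0 : ∀ (τ : ι → ℝ) (t : ℝ), (∀ k, 0 ≤ τ k) → 0 ≤ t →
        ∀ k', 0 ≤ Function.update τ k t k' := by
      intro τ t hτ ht k'
      by_cases hkk : k' = k
      · subst hkk; simpa using ht
      · simpa [hkk] using hτ k'
    have hconv : ∀ k, ConvexOn ℝ D (a k) := fun k => convexOn_affine _ hG.1
    by_cases hc : ∃ x₁ ∈ D, (∀ k ∈ s, a k x₁ ≤ 0) ∧ a k x₁ < 0
    · obtain ⟨x₁, hx₁, hx₁s, hx₁k⟩ := hc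
      have hsub : {x ∈ D | ∀ k ∈ s, a k x ≤ 0} ⊆ D := fun x hx => hx.1
      have hD' : Convex ℝ {x ∈ D | ∀ k ∈ s, a k x ≤ 0} := by
        rintro x ⟨hx, hx'⟩ y ⟨hy, hy'⟩ α β hα hβ hαβ
        refine ⟨hG.1 hx hy hα hβ hαβ, fun k hk => ?_⟩
        have := (hconv k).2 hx hy hα hβ hαβ
        simp only [smul_eq_mul] at this
        nlinarith [hx' k hk, hy' k hk]
      obtain ⟨t, ht, ht'⟩ := exists_multiplier_of_slater (hG.subset hsub hD')
        ((hconv k).subset hsub hD') (x₀ := x₁) ⟨hx₁, hx₁s⟩ hx₁k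
        (v := v) (fun x hx hx' => hv x hx.1 (by
          intro k' hk'
          rcases Finset.mem_insert.1 hk' with rfl | hk'
          exacts [hx', hx.2 k' hk']))
      obtain ⟨τ, hτ, hτ'⟩ := ih (G := fun x => G x + t * a k x) hri
        (hG.add ((hconv k).smul ht)) (fun x hx hx' => ht' x ⟨hx, hx'⟩)
      refine ⟨Function.update τ k t, hupd0 τ t hτ ht, fun x hx => ?_⟩
      rw [hupd]
      linarith [hτ' x hx]
    · push Not at hc
      -- No point feasible for the other constraints is strict for `k`, so `a k` has lower bound `0`
      -- under them. Pricing that bound makes `a k + ∑ σ a` nonnegative on `D`; being nonpositive at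
      -- `x₀`, it vanishes on `D`.
      obtain ⟨σ, hσ, hσ'⟩ := ih (v := 0) hri (hconv k) hc
      let b : X →ᵃ[ℝ] ℝ := a k + ∑ k' ∈ s, σ k' • a k'
      have hb : ∀ x, b x = a k x + ∑ k' ∈ s, σ k' * a k' x := by
        intro x
        have h1 : ∀ s : Finset ι, (∑ k' ∈ s, σ k' • a k') x = ∑ k' ∈ s, σ k' * a k' x := by
          intro s
          induction s using Finset.induction_on with
          | empty => simp
          | insert k s hk ih => simp [Finset.sum_insert hk, ih]
        simp [b, h1]
      have hb0 : ∀ x ∈ D, b x = 0 := by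
        refine hri.eq_zero_of_nonneg b (fun x hx => by rw [hb]; exact hσ' x hx) ?_
        rw [hb]
        have := Finset.sum_nonpos fun k' hk' => mul_nonpos_of_nonneg_of_nonpos (hσ k') (hs' k' hk')
        linarith
      have hak : a k x₀ = 0 := le_antisymm hsk (hc x₀ hri.1 hs')
      have hsub : {x ∈ D | a k x = 0} ⊆ D := fun x hx => hx.1
      have hD' : Convex ℝ {x ∈ D | a k x = 0} := by
        rintro x ⟨hx, hx'⟩ y ⟨hy, hy'⟩ α β hα hβ hαβ
        refine ⟨hG.1 hx hy hα hβ hαβ, ?_⟩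
        rw [Convex.combo_affine_apply hαβ, hx', hy']; simp
      obtain ⟨τ, hτ, hτ'⟩ := ih (hri.inter_affine (a k) hak) (hG.subset hsub hD') (v := v) (by
        intro x hx hx'
        refine hv x hx.1 fun k' hk' => ?_
        rcases Finset.mem_insert.1 hk' with rfl | hk'
        exacts [hx.2.le, hx' k' hk'])
      have hG' := convexOn_add_sum hG s (fun k _ => hconv k) hτ
      obtain ⟨μ, hμ⟩ : ∃ μ : ℝ, ∀ x ∈ D, v ≤ (G x + ∑ k ∈ s, τ k * a k x) + μ * a k x := by
        by_cases hneg : ∃ x₁ ∈ D, a k x₁ < 0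
        · obtain ⟨x₁, hx₁, hx₁'⟩ := hneg
          obtain ⟨t, ht, hx₂⟩ := hri.2 x₁ hx₁
          refine exists_multiplier_of_eq hG' (a k) hx₁ hx₁' hx₂ ?_ fun x hx hx' => hτ' x ⟨hx, hx'⟩
          rw [affine_reflect, hak]
          nlinarith
        · push Not at hneg
          have := hri.eq_zero_of_nonneg (a k) hneg hsk
          exact ⟨0, fun x hx => by simpa using hτ' x ⟨hx, this x hx⟩⟩
      -- The multiplier of the equation `a k = 0` may be negative. In that case `a k = -∑ σ a` on
      -- `D` turns its term into a nonnegative combination of the other constraints.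
      rcases le_total 0 μ with h0 | h0
      · refine ⟨Function.update τ k μ, hupd0 τ μ hτ h0, fun x hx => ?_⟩
        rw [hupd]
        linarith [hμ x hx]
      · refine ⟨Function.update (fun k' => τ k' + -μ * σ k') k 0,
          hupd0 _ _ (fun k' => add_nonneg (hτ k') (mul_nonneg (by linarith) (hσ k'))) le_rfl,
          fun x hx => ?_⟩
        rw [hupd]
        have h1 := hb0 x hx
        rw [hb] at h1
        have h2 : ∑ k' ∈ s, (τ k' + -μ * σ k') * a k' x
            = ∑ k' ∈ s, τ k' * a k' x + -μ * ∑ k' ∈ s, σ k' * a k' x := by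
          rw [Finset.mul_sum, ← Finset.sum_add_distrib]
          exact Finset.sum_congr rfl fun _ _ => by ring
        have h3 : -μ * ∑ k' ∈ s, σ k' * a k' x = μ * a k x := by
          have : ∑ k' ∈ s, σ k' * a k' x = - a k x := by linarith
          rw [this]; ring
        have := hμ x hx
        simp only [zero_mul, zero_add]
        rw [h2, h3]
        linarith

/-- Lagrange multipliers for affine inequalities and linear equations. -/
theorem exists_multipliers_of_affine_eq {ι Y : Type*} [Fintype ι] [AddCommGroup Y] [Module ℝ Y]
    [FiniteDimensional ℝ Y] (a : ι → X →ᵃ[ℝ] ℝ) (T : X →ₗ[ℝ] Y) {x₀ : X}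
    (ha : ∀ k, a k x₀ ≤ 0) (hT : T x₀ = 0) {D : Set X} {G : X → ℝ} {v : ℝ} (hri : AlgRelInt D x₀)
    (hG : ConvexOn ℝ D G) (hv : ∀ x ∈ D, (∀ k, a k x ≤ 0) → T x = 0 → v ≤ G x) :
    ∃ (τ : ι → ℝ) (y : Module.Dual ℝ Y), (∀ k, 0 ≤ τ k) ∧
      ∀ x ∈ D, v ≤ G x + ∑ k, τ k * a k x + y (T x) := by
  let B := Module.finBasis ℝ Y
  -- Each coordinate of `T x = 0` becomes two opposite inequalities, whose multipliers are
  -- subtracted to form the functional `y`.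
  let c : Fin (Module.finrank ℝ Y) ⊕ Fin (Module.finrank ℝ Y) → X →ᵃ[ℝ] ℝ :=
    Sum.elim (fun b => (B.coord b ∘ₗ T).toAffineMap) (fun b => (-(B.coord b ∘ₗ T)).toAffineMap)
  obtain ⟨τ, hτ, hτ'⟩ := exists_multipliers_of_affine (Sum.elim a c) (x₀ := x₀) Finset.univ
    (by rintro (k | b | b) _ <;> simp [c, ha, hT]) hri hG (v := v) (by
      intro x hx hx'
      refine hv x hx (fun k => hx' (Sum.inl k) (Finset.mem_univ _)) ?_
      refine B.repr.map_eq_zero_iff.1 (Finsupp.ext fun b => ?_)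
      have h1 := hx' (Sum.inr (Sum.inl b)) (Finset.mem_univ _)
      have h2 := hx' (Sum.inr (Sum.inr b)) (Finset.mem_univ _)
      simp [c] at h1 h2
      simpa using le_antisymm h1 h2)
  refine ⟨fun k => τ (Sum.inl k),
    ∑ b, (τ (Sum.inr (Sum.inl b)) - τ (Sum.inr (Sum.inr b))) • B.coord b,
    fun k => hτ _, fun x hx => ?_⟩
  have h1 := hτ' x hx
  simp only [Fintype.sum_sum_type, Sum.elim_inl, Sum.elim_inr, c] at h1
  refine h1.trans (le_of_eq ?_)
  simp only [LinearMap.sum_apply, LinearMap.smul_apply, smul_eq_mul, LinearMap.coe_toAffineMap,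
    LinearMap.neg_apply, LinearMap.comp_apply, sub_mul, Finset.sum_sub_distrib, mul_neg,
    Finset.sum_neg_distrib]
  ring

/-- Lagrange multipliers under the Slater condition for convex inequalities, affine inequalities and
linear equations. -/
theorem exists_lagrange_multipliers {κ ι Y : Type*} [Fintype κ] [Fintype ι] [AddCommGroup Y]
    [Module ℝ Y] [FiniteDimensional ℝ Y] {D : Set X} {G : X → ℝ} (hG : ConvexOn ℝ D G)
    {h : κ → X → ℝ} (hh : ∀ k, ConvexOn ℝ D (h k)) (a : ι → X →ᵃ[ℝ] ℝ) (T : X →ₗ[ℝ] Y) {x₀ : X}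
    (hri : AlgRelInt D x₀) (hs : ∀ k, h k x₀ < 0) (ha : ∀ k, a k x₀ ≤ 0) (hT : T x₀ = 0) {v : ℝ}
    (hv : ∀ x ∈ D, (∀ k, h k x ≤ 0) → (∀ k, a k x ≤ 0) → T x = 0 → v ≤ G x) :
    ∃ (τ : κ → ℝ) (σ : ι → ℝ) (y : Module.Dual ℝ Y), (∀ k, 0 ≤ τ k) ∧ (∀ k, 0 ≤ σ k) ∧
      ∀ x ∈ D, v ≤ G x + ∑ k, τ k * h k x + ∑ k, σ k * a k x + y (T x) := by
  -- Strict constraints go first: pricing them on `D'` needs only a strictly feasible point. The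
  -- affine ones need `x₀` in the relative interior, which is known for `D` itself.
  let D' : Set X := {x ∈ D | (∀ k, a k x ≤ 0) ∧ T x = 0}
  have hsub : D' ⊆ D := fun x hx => hx.1
  have hD' : Convex ℝ D' := by
    rintro x ⟨hx, hx', hxT⟩ y ⟨hy, hy', hyT⟩ α β hα hβ hαβ
    refine ⟨hG.1 hx hy hα hβ hαβ, fun k => ?_, by simp [hxT, hyT]⟩
    have := (convexOn_affine (a k) hG.1).2 hx hy hα hβ hαβ
    simp only [smul_eq_mul] at this
    nlinarith [hx' k, hy' k]
  obtain ⟨τ, hτ, hτ'⟩ := exists_multipliers_of_slater (h := h) (D := D') (x₀ := x₀)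
    ⟨hri.1, ha, hT⟩ (v := v) Finset.univ (hG.subset hsub hD') (fun k _ => (hh k).subset hsub hD')
    (fun k _ => hs k) (fun x hx hx' => hv x hx.1 (fun k => hx' k (Finset.mem_univ _)) hx.2.1 hx.2.2)
  obtain ⟨σ, y, hσ, hy⟩ := exists_multipliers_of_affine_eq a T ha hT hri
    (convexOn_add_sum hG Finset.univ (fun k _ => hh k) hτ) (v := v)
    (fun x hx hx' hxT => hτ' x ⟨hx, hx', hxT⟩)
  exact ⟨τ, σ, y, hτ, hσ, hy⟩

end Lagrange

/-! Fenchel–Lagrange duality for extended real-valued convex functions. -/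

section FenchelLagrange

variable {V : Type*} [NormedAddCommGroup V] [InnerProductSpace ℝ V]

theorem algRelInt_of_mem_intrinsicInterior {D : Set V} {x₀ : V}
    (h : x₀ ∈ intrinsicInterior ℝ D) : AlgRelInt D x₀ := by
  refine ⟨intrinsicInterior_subset h, fun x hx => ?_⟩
  obtain ⟨y, hy, rfl⟩ := mem_intrinsicInterior.1 h
  have hmem : ∀ t : ℝ, (y : V) + t • ((y : V) - x) ∈ affineSpan ℝ D := by
    intro t
    have := AffineMap.lineMap_mem (-t) y.2 (subset_affineSpan ℝ D hx)
    rw [AffineMap.lineMap_apply] at this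
    convert this using 1
    simp [vsub_eq_sub, smul_sub]
    abel
  let γ : ℝ → affineSpan ℝ D := fun t => ⟨(y : V) + t • ((y : V) - x), hmem t⟩
  have hγ : Continuous γ := by
    refine Continuous.subtype_mk ?_ _
    fun_prop
  have h0 : γ 0 = y := Subtype.ext (by simp [γ])
  have h1 : ∀ᶠ t in 𝓝 (0 : ℝ), γ t ∈ interior ((↑) ⁻¹' D : Set (affineSpan ℝ D)) :=
    hγ.continuousAt.eventually_mem (isOpen_interior.mem_nhds (by rw [h0]; exact hy))
  obtain ⟨t, ht, ht0⟩ := ((h1.filter_mono nhdsWithin_le_nhds).and self_mem_nhdsWithin :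
    ∀ᶠ t in 𝓝[>] (0 : ℝ), _ ∧ _).exists
  exact ⟨t, ht0, interior_subset (s := ((↑) ⁻¹' D : Set (affineSpan ℝ D))) ht⟩

theorem AlgRelInt.eventually {X : Type*} [AddCommGroup X] [Module ℝ X] {D : Set X} {x₀ : X}
    (h : AlgRelInt D x₀) (hD : Convex ℝ D) {x : X} (hx : x ∈ D) :
    ∀ᶠ t in 𝓝[>] (0 : ℝ), x₀ + t • (x₀ - x) ∈ D := by
  obtain ⟨t, ht, hx'⟩ := h.2 x hx
  filter_upwards [Ioc_mem_nhdsGT ht] with s hs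
  have h1 : s / t ≤ 1 := (div_le_one ht).2 hs.2
  have := hD h.1 hx' (a := 1 - s / t) (b := s / t) (by linarith) (div_nonneg hs.1.le ht.le) (by ring)
  convert this using 1
  rw [smul_add, smul_smul, div_mul_cancel₀ _ ht.ne', sub_smul, one_smul]
  abel

theorem coe_toReal_of_mem_dom {W : Type*} {f : W → EReal} (hf : ∀ x, ⊥ < f x) {x : W} (hx : x ∈ dom f) :
    ((f x).toReal : EReal) = f x :=
  EReal.coe_toReal hx.ne (hf x).ne'

theorem IsConvexFun.convexOn {f : V → EReal} (hc : IsConvexFun f) (hf : ∀ x, ⊥ < f x) :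
    ConvexOn ℝ (dom f) (fun x => (f x).toReal) := by
  have key : ∀ ⦃x⦄, x ∈ dom f → ∀ ⦃y⦄, y ∈ dom f → ∀ ⦃a b : ℝ⦄, 0 ≤ a → 0 ≤ b → a + b = 1 →
      f (a • x + b • y) ≤ ((a * (f x).toReal + b * (f y).toReal : ℝ) : EReal) := by
    intro x hx y hy a b ha hb hab
    exact hc (x := (x, (f x).toReal)) (y := (y, (f y).toReal)) (coe_toReal_of_mem_dom hf hx).ge
      (coe_toReal_of_mem_dom hf hy).ge ha hb hab
  have hD : Convex ℝ (dom f) := fun x hx y hy a b ha hb hab =>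
    (key hx hy ha hb hab).trans_lt (EReal.coe_lt_top _)
  refine ⟨hD, fun x hx y hy a b ha hb hab => ?_⟩
  have := key hx hy ha hb hab
  rw [← coe_toReal_of_mem_dom hf (hD hx hy ha hb hab)] at this
  exact EReal.coe_le_coe_iff.1 this

theorem ereal_coe_sum {N : Type*} (s : Finset N) (g : N → ℝ) :
    ((∑ n ∈ s, g n : ℝ) : EReal) = ∑ n ∈ s, (g n : EReal) := by
  classical
  induction s using Finset.induction_on with
  | empty => simp
  | insert n s hn ih => rw [Finset.sum_insert hn, Finset.sum_insert hn, EReal.coe_add, ih]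

/-- The summands vary independently, so the suprema add up to the supremum of the sums. This splits
a joint Lagrangian bound into separate bounds, one for each conjugate or each atom. -/
theorem exists_upper_bounds {N : Type*} [Fintype N] {A : N → Set ℝ} (hA : ∀ n, (A n).Nonempty)
    {s : ℝ} (h : ∀ a : N → ℝ, (∀ n, a n ∈ A n) → ∑ n, a n ≤ s) :
    ∃ b : N → ℝ, (∀ n, ∀ a ∈ A n, a ≤ b n) ∧ ∑ n, b n ≤ s := by
  classical
  choose a₀ ha₀ using hA
  have hbdd : ∀ n, BddAbove (A n) := by
    intro n
    refine ⟨s - ∑ k ∈ Finset.univ.erase n, a₀ k, fun r hr => ?_⟩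
    have h1 := h (Function.update a₀ n r) (fun k => by
      by_cases hk : k = n
      · subst hk; simpa using hr
      · simpa [hk] using ha₀ k)
    rw [← Finset.add_sum_erase _ _ (Finset.mem_univ n), Function.update_self,
      Finset.sum_congr rfl (g := a₀)] at h1
    · linarith
    · intro k hk
      rw [Function.update_of_ne (Finset.ne_of_mem_erase hk)]
  refine ⟨fun n => sSup (A n), fun n a ha => le_csSup (hbdd n) ha, ?_⟩
  refine le_of_forall_pos_le_add fun δ hδ => ?_
  have hδ' : 0 < δ / (Fintype.card N + 1) := by positivity
  choose a ha ha' using fun n => exists_lt_of_lt_csSup ⟨a₀ n, ha₀ n⟩ (sub_lt_self (sSup (A n)) hδ')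
  have h1 := h a ha
  have h2 : ∑ n, (sSup (A n) - δ / (Fintype.card N + 1)) ≤ ∑ n, a n :=
    Finset.sum_le_sum fun n _ => (ha' n).le
  rw [Finset.sum_sub_distrib, Finset.sum_const, Finset.card_univ, nsmul_eq_mul] at h2
  have h3 : (Fintype.card N : ℝ) * (δ / (Fintype.card N + 1)) ≤ δ := by
    rw [mul_div_assoc', div_le_iff₀ (by positivity)]
    nlinarith
  linarith

theorem conj_le_coe {f : V → EReal} (hf : ∀ x, ⊥ < f x) {ζ : V} {b : ℝ}
    (h : ∀ x ∈ dom f, ⟪ζ, x⟫ - (f x).toReal ≤ b) : conj f ζ ≤ b := by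
  refine iSup_le fun x => ?_
  by_cases hx : x ∈ dom f
  · rw [← coe_toReal_of_mem_dom hf hx]
    exact_mod_cast h x hx
  · have : f x = ⊤ := not_lt_top_iff.1 hx
    simp [this]

theorem le_conj (f : V → EReal) (ζ x : V) : ((⟪ζ, x⟫ : ℝ) : EReal) - f x ≤ conj f ζ :=
  le_iSup (fun x => ((⟪ζ, x⟫ : ℝ) : EReal) - f x) x

theorem inner_sub_le_of_conj_le {f : V → EReal} (hf : ∀ x, ⊥ < f x) {ζ : V} {b : ℝ}
    (h : conj f ζ ≤ b) {x : V} (hx : x ∈ dom f) : ⟪ζ, x⟫ - (f x).toReal ≤ b := by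
  have := (le_conj f ζ x).trans h
  rw [← coe_toReal_of_mem_dom hf hx] at this
  exact_mod_cast this

/-- A half-space containing the domain of `f` contains the domain of the biconjugate. -/
theorem supportFun_dom_conj_conj_le {f : V → EReal} (hf : ∀ x, ⊥ < f x) {η : V}
    (hη : conj f η < ⊤) {ζ : V} {b : ℝ} (h : ∀ x ∈ dom f, ⟪ζ, x⟫ ≤ b) :
    supportFun (dom (conj (conj f))) ζ ≤ b := by
  obtain ⟨c, hc⟩ : ∃ c : ℝ, conj f η ≤ c := ⟨(conj f η).toReal, EReal.le_coe_toReal hη.ne⟩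
  refine iSup₂_le fun y hy => ?_
  by_contra! hlt
  have hlt' : b < ⟪y, ζ⟫ := by exact_mod_cast hlt
  obtain ⟨r, hr⟩ : ∃ r : ℝ, conj (conj f) y ≤ r := ⟨_, EReal.le_coe_toReal hy.ne⟩
  -- Moving from `η` to `η + t • ζ` raises the bound on the conjugate by `t * b` only. Letting `t`
  -- grow in the bound on the biconjugate at `y` contradicts `b < ⟪y, ζ⟫`, without any appeal to
  -- `f** = f`.
  have key : ∀ t : ℝ, 0 ≤ t → ⟪y, η⟫ + t * ⟪y, ζ⟫ - (c + t * b) ≤ r := by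
    intro t ht
    have h1 : conj f (η + t • ζ) ≤ ((c + t * b : ℝ) : EReal) := by
      refine conj_le_coe hf fun x hx => ?_
      have h2 := inner_sub_le_of_conj_le hf hc hx
      rw [inner_add_left, real_inner_smul_left]
      nlinarith [h x hx]
    have h3 := (EReal.sub_le_sub le_rfl h1).trans ((le_conj (conj f) y (η + t • ζ)).trans hr)
    rw [inner_add_right, real_inner_smul_right] at h3
    exact_mod_cast h3
  have h1 := key (max 0 ((r - ⟪y, η⟫ + c + 1) / (⟪y, ζ⟫ - b))) (le_max_left _ _)
  have h2 := le_max_right 0 ((r - ⟪y, η⟫ + c + 1) / (⟪y, ζ⟫ - b))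
  rw [div_le_iff₀ (by linarith)] at h2
  nlinarith

theorem coe_mul_le_coe {t b : ℝ} (ht : 0 < t) {r : EReal} (h : r ≤ ((b / t : ℝ) : EReal)) :
    (t : EReal) * r ≤ b := by
  calc (t : EReal) * r ≤ t * ((b / t : ℝ) : EReal) := by gcongr
    _ = b := by rw [← EReal.coe_mul, mul_div_cancel₀ _ ht.ne']

/-- For `τ > 0` the scaled conjugate is the supremum of `⟪ζ, x⟫ - τ f x` over the domain. At `τ = 0`
the perspective is a support function of the domain of the biconjugate, and the half-space bound
extends to it. -/
theorem persp_conj_le {f : V → EReal} (hf : ∀ x, ⊥ < f x) {η : V} (hη : conj f η < ⊤) {ζ : V}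
    {τ b : ℝ} (hτ : 0 ≤ τ) (h : ∀ x ∈ dom f, ⟪ζ, x⟫ - τ * (f x).toReal ≤ b) :
    persp (conj f) ζ τ ≤ b := by
  unfold persp
  split_ifs with h0
  · refine coe_mul_le_coe h0 (conj_le_coe hf fun x hx => ?_)
    rw [real_inner_smul_left, le_div_iff₀ h0]
    have := h x hx
    field_simp
    linarith
  · obtain rfl : τ = 0 := le_antisymm (not_lt.1 h0) hτ
    exact supportFun_dom_conj_conj_le hf hη (by simpa using h)

theorem persp_conj_le_of_conj_mul_le {f : V → EReal} (hf : ∀ x, ⊥ < f x) {ζ : V} {t b : ℝ}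
    (ht : 0 < t) (h : conj (fun x => (t : EReal) * f x) ζ ≤ b) : persp (conj f) ζ t ≤ b := by
  rw [persp, if_pos ht]
  refine coe_mul_le_coe ht (conj_le_coe hf fun x hx => ?_)
  have h1 := (le_conj (fun x => (t : EReal) * f x) ζ x).trans h
  rw [← coe_toReal_of_mem_dom hf hx] at h1
  have h2 : ⟪ζ, x⟫ - t * (f x).toReal ≤ b := by exact_mod_cast h1
  rw [real_inner_smul_left, le_div_iff₀ ht]
  field_simp
  linarith

theorem conj_conj_le {f : V → EReal} {x : V} {r : ℝ} (hr : f x ≤ r) : conj (conj f) x ≤ r := by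
  refine iSup_le fun η => ?_
  have h1 := (EReal.sub_le_sub le_rfl hr).trans (le_conj f η x)
  refine (EReal.sub_le_sub le_rfl h1).trans (le_of_eq ?_)
  rw [real_inner_comm, ← EReal.coe_sub, ← EReal.coe_sub, sub_sub_cancel]

/-- Fenchel–Young for perspectives. At `τ = 0` it needs `x` in the domain of the biconjugate, which
follows from `f** ≤ f`. -/
theorem le_persp_conj {f : V → EReal} {x : V} {r : ℝ} (hr : f x ≤ r) (ζ : V) {τ : ℝ} (hτ : 0 ≤ τ) :
    ((⟪ζ, x⟫ - τ * r : ℝ) : EReal) ≤ persp (conj f) ζ τ := by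
  unfold persp
  split_ifs with h0
  · have h1 := (EReal.sub_le_sub le_rfl hr).trans (le_conj f (τ⁻¹ • ζ) x)
    have h2 : (τ : EReal) * ((⟪τ⁻¹ • ζ, x⟫ - r : ℝ) : EReal) ≤ τ * conj f (τ⁻¹ • ζ) := by
      gcongr
      exact h1
    refine (le_of_eq ?_).trans h2
    rw [← EReal.coe_mul, real_inner_smul_left, mul_sub, mul_inv_cancel_left₀ h0.ne']
  · obtain rfl : τ = 0 := le_antisymm (not_lt.1 h0) hτ
    have h1 : x ∈ dom (conj (conj f)) := (conj_conj_le hr).trans_lt (EReal.coe_lt_top _)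
    rw [zero_mul, sub_zero, real_inner_comm]
    exact le_iSup₂ (f := fun y (_ : y ∈ dom (conj (conj f))) => ((⟪y, ζ⟫ : ℝ) : EReal)) x h1

theorem IsConvexFun.const_mul {f : V → EReal} (hf : IsConvexFun f) {t : ℝ} (ht : 0 < t) :
    IsConvexFun (fun x => (t : EReal) * f x) := by
  have key : ∀ (x : V) (r : ℝ), (t : EReal) * f x ≤ r ↔ f x ≤ ((r / t : ℝ) : EReal) := by
    refine fun x r => ⟨fun h => ?_, coe_mul_le_coe ht⟩
    have h1 := coe_mul_le_coe (b := r / t) (inv_pos.2 ht) (r := t * f x) (by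
      rwa [div_inv_eq_mul, div_mul_cancel₀ _ ht.ne'])
    rwa [← mul_assoc, ← EReal.coe_mul, inv_mul_cancel₀ ht.ne', EReal.coe_one, one_mul] at h1
  rintro ⟨x, r⟩ hx ⟨y, s⟩ hy a b ha hb hab
  have h1 := hf (x := (x, r / t)) (y := (y, s / t)) ((key x r).1 hx) ((key y s).1 hy) ha hb hab
  refine (key _ _).2 (le_trans h1 (le_of_eq ?_))
  simp only [Prod.smul_mk, Prod.mk_add_mk, smul_eq_mul]
  congr 1
  ring

theorem isConvexFun_coe {g : V → ℝ} (hg : ConvexOn ℝ univ g) :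
    IsConvexFun (fun x => (g x : EReal)) := by
  rintro ⟨x, r⟩ hx ⟨y, s⟩ hy a b ha hb hab
  have hx' : g x ≤ r := EReal.coe_le_coe_iff.1 hx
  have hy' : g y ≤ s := EReal.coe_le_coe_iff.1 hy
  refine EReal.coe_le_coe_iff.2 ((hg.2 (mem_univ x) (mem_univ y) ha hb hab).trans ?_)
  exact add_le_add (mul_le_mul_of_nonneg_left hx' ha) (mul_le_mul_of_nonneg_left hy' hb)

theorem algRelInt_dom_coe (g : V → ℝ) (x₀ : V) : AlgRelInt (dom fun x => (g x : EReal)) x₀ :=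
  ⟨EReal.coe_lt_top _, fun _ _ => ⟨1, one_pos, EReal.coe_lt_top _⟩⟩

variable [FiniteDimensional ℝ V]

theorem exists_inner_eq (y : Module.Dual ℝ V) : ∃ w : V, ∀ x, y x = ⟪w, x⟫ :=
  ⟨(InnerProductSpace.toDual ℝ V).symm (LinearMap.toContinuousLinearMap y), fun x => by
    rw [InnerProductSpace.toDual_symm_apply]; rfl⟩

/-- Subgradients exist in the relative interior of the domain. -/
theorem exists_subgradient {D : Set V} {G : V → ℝ} (hG : ConvexOn ℝ D G) {x₀ : V}
    (hx₀ : AlgRelInt D x₀) : ∃ η : V, ∀ x ∈ D, G x₀ + ⟪η, x - x₀⟫ ≤ G x := by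
  have hri : AlgRelInt ((fun x => x₀ + x) ⁻¹' D) 0 := by
    refine ⟨by simpa using hx₀.1, fun x hx => ?_⟩
    obtain ⟨t, ht, h⟩ := hx₀.2 _ hx
    exact ⟨t, ht, by simpa using h⟩
  -- Minimize the translated function subject to `x = 0`: the negative of the equation's multiplier
  -- is a subgradient.
  obtain ⟨_, _, y, _, _, hy⟩ := exists_lagrange_multipliers (hG.translate_right x₀) (κ := Empty)
    (ι := Empty) (h := fun k => k.elim) (fun k => k.elim) (fun k => k.elim)
    (LinearMap.id : V →ₗ[ℝ] V) hri (fun k => k.elim) (fun k => k.elim) rfl (v := G x₀) (by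
      rintro x - - - hx
      obtain rfl : x = 0 := hx
      simp)
  obtain ⟨w, hw⟩ := exists_inner_eq y
  refine ⟨-w, fun x hx => ?_⟩
  have := hy (x - x₀) (by simpa using hx)
  simp only [Finset.univ_eq_empty, Finset.sum_empty, add_zero, LinearMap.id_apply, hw,
    Function.comp_apply, add_sub_cancel] at this
  rw [inner_neg_left]
  linarith

theorem exists_conj_lt_top {f : V → EReal} (hf : ∀ x, ⊥ < f x) (hc : IsConvexFun f) {x₀ : V}
    (hx₀ : AlgRelInt (dom f) x₀) : ∃ η : V, conj f η < ⊤ := by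
  obtain ⟨η, hη⟩ := exists_subgradient (hc.convexOn hf) hx₀
  refine ⟨η, (conj_le_coe hf (b := ⟪η, x₀⟫ - (f x₀).toReal) fun x hx => ?_).trans_lt
    (EReal.coe_lt_top _)⟩
  have := hη x hx
  rw [inner_sub_right] at this
  linarith

/-- The Lagrange multiplier theorem for separable convex programs with linked copies of the variable,
in terms of real-valued functions. -/
theorem exists_split_multipliers {ι : Type*} [Fintype ι] {K : ℕ} {u : ι → V → EReal}
    {f : Fin K → V → EReal} (hu : ∀ n x, ⊥ < u n x) (hf : ∀ k x, ⊥ < f k x)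
    (hcu : ∀ n, IsConvexFun (u n)) (hcf : ∀ k, IsConvexFun (f k)) {x₀ : V}
    (hxu : ∀ n, AlgRelInt (dom (u n)) x₀) (hxf : IsSlaterPoint f x₀) {v : ℝ}
    (hv : ∀ x, (∀ k, f k x ≤ 0) → (v : EReal) ≤ ∑ n, u n x) :
    ∃ (τ : Fin K → ℝ) (y : ι → V) (ζ : Fin K → V), (∀ k, 0 ≤ τ k) ∧ ∑ n, y n + ∑ k, ζ k = 0 ∧
      ∀ (w : ι → V) (w' : Fin K → V), (∀ n, w n ∈ dom (u n)) → (∀ k, w' k ∈ dom (f k)) →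
        ∑ n, (⟪y n, w n⟫ - (u n (w n)).toReal) + ∑ k, (⟪ζ k, w' k⟫ - τ k * (f k (w' k)).toReal)
          ≤ -v := by
  classical
  -- Every objective and constraint function gets its own copy `p.2 n` of the variable, tied to the
  -- common copy `p.1` by `T p = 0`. Pricing these equations makes the Lagrangian separable.
  let N := ι ⊕ Fin K
  let h : N → V → EReal := Sum.elim u f
  have hh : ∀ n x, ⊥ < h n x := by rintro (n | k) x; exacts [hu n x, hf k x]
  have hch : ∀ n, IsConvexFun (h n) := by rintro (n | k); exacts [hcu n, hcf k]
  have hxh : ∀ n, AlgRelInt (dom (h n)) x₀ := by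
    rintro (n | k); exacts [hxu n, algRelInt_of_mem_intrinsicInterior (hxf.2.1 k)]
  have hch' : ∀ n, ConvexOn ℝ (dom (h n)) (fun x => (h n x).toReal) :=
    fun n => (hch n).convexOn (hh n)
  let D : Set (V × (N → V)) := {p | ∀ n, p.2 n ∈ dom (h n)}
  have hD : Convex ℝ D := fun p hp q hq a b ha hb hab n => (hch' n).1 (hp n) (hq n) ha hb hab
  have hcD : ∀ n, ConvexOn ℝ D (fun p => (h n (p.2 n)).toReal) := fun n =>
    ⟨hD, fun p hp q hq a b ha hb hab => (hch' n).2 (hp n) (hq n) ha hb hab⟩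
  have hri : AlgRelInt D (x₀, fun _ => x₀) := by
    refine ⟨fun n => (hxh n).1, fun p hp => ?_⟩
    have h1 : ∀ᶠ t in 𝓝[>] (0 : ℝ), ∀ n, x₀ + t • (x₀ - p.2 n) ∈ dom (h n) :=
      eventually_all.2 fun n => (hxh n).eventually (hch' n).1 (hp n)
    obtain ⟨t, ht, ht0⟩ := (h1.and self_mem_nhdsWithin).exists
    exact ⟨t, ht0, fun n => ht n⟩
  have hG : ConvexOn ℝ D (fun p => ∑ n : ι, (u n (p.2 (Sum.inl n))).toReal) := by
    have := convexOn_add_sum (convexOn_const (0 : ℝ) hD) Finset.univ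
      (fun (n : ι) _ => hcD (Sum.inl n)) (τ := fun _ => 1) (fun _ => zero_le_one)
    simpa [h] using this
  -- Constraints are sorted by strictness at `x₀` rather than by affinity; the Slater condition
  -- makes the non-strict ones affine.
  have haff : ∀ k : {k // ¬ f k x₀ < 0}, IsAffineFun (f k) := by
    rintro ⟨k, hk⟩
    by_contra hna
    exact hk (hxf.2.2 k hna)
  choose g b hgb using haff
  let a : {k // ¬ f k x₀ < 0} → (V × (N → V)) →ᵃ[ℝ] ℝ := fun k =>
    ((innerSL ℝ (g k)).toLinearMap ∘ₗ LinearMap.proj (Sum.inr k.1) ∘ₗ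
      LinearMap.snd ℝ V (N → V)).toAffineMap + AffineMap.const ℝ _ (b k)
  have ha : ∀ k p, a k p = (f k (p.2 (Sum.inr k.1))).toReal := by
    intro k p
    rw [hgb, EReal.toReal_coe]
    rfl
  let T : (V × (N → V)) →ₗ[ℝ] (N → V) :=
    LinearMap.snd ℝ V (N → V) - LinearMap.pi fun _ => LinearMap.fst ℝ V (N → V)
  have hT : ∀ p n, T p n = p.2 n - p.1 := fun p n => rfl
  obtain ⟨τ, σ, y, hτ, hσ, hy⟩ := exists_lagrange_multipliers hG (v := v)
    (h := fun (k : {k // f k x₀ < 0}) p => (f k (p.2 (Sum.inr k.1))).toReal)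
    (fun k => hcD (Sum.inr k.1)) a T hri (fun k => by
      have h1 := k.2
      rw [← coe_toReal_of_mem_dom (hf k) (hxh (Sum.inr k.1)).1] at h1
      exact_mod_cast h1) (fun k => by
      rw [ha]
      have h1 := hxf.1 k
      rw [← coe_toReal_of_mem_dom (hf k) (hxh (Sum.inr k.1)).1] at h1
      exact_mod_cast h1) (by ext n; simp [hT]) (by
      intro p hp hs haf hTp
      have hx : ∀ n, p.2 n = p.1 := fun n => by
        have := congrFun hTp n
        rw [hT] at this
        exact sub_eq_zero.1 this
      have h1 := hv p.1 fun k => by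
        have h2 : (f k p.1).toReal ≤ 0 := by
          by_cases hk : f k x₀ < 0
          · have := hs ⟨k, hk⟩
            rwa [hx] at this
          · have := haf ⟨k, hk⟩
            rwa [ha, hx] at this
        have h3 := hp (Sum.inr k)
        rw [hx] at h3
        rw [← coe_toReal_of_mem_dom (hf k) h3]
        exact_mod_cast h2
      have h4 : ∑ n : ι, u n p.1 = ((∑ n : ι, (u n (p.2 (Sum.inl n))).toReal : ℝ) : EReal) := by
        rw [ereal_coe_sum]
        refine Finset.sum_congr rfl fun n _ => ?_
        have h3 := hp (Sum.inl n)
        rw [hx] at h3 ⊢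
        exact (coe_toReal_of_mem_dom (hu n) h3).symm
      rw [h4] at h1
      exact_mod_cast h1)
  choose Y hY using fun n => exists_inner_eq (y ∘ₗ LinearMap.single ℝ (fun _ : N => V) n)
  have hyY : ∀ w : N → V, y w = ∑ n, ⟪Y n, w n⟫ := by
    intro w
    conv_lhs => rw [← Finset.univ_sum_single w, map_sum]
    exact Finset.sum_congr rfl fun n _ => hY n (w n)
  let ρ : Fin K → ℝ := fun k => if hk : f k x₀ < 0 then τ ⟨k, hk⟩ else σ ⟨k, hk⟩
  have hρ : ∀ k, 0 ≤ ρ k := by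
    intro k
    simp only [ρ]
    split_ifs with hk
    exacts [hτ _, hσ _]
  have main : ∀ x (w : N → V), (∀ n, w n ∈ dom (h n)) →
      v ≤ ∑ n : ι, (u n (w (Sum.inl n))).toReal + ∑ k, ρ k * (f k (w (Sum.inr k))).toReal
        + ∑ n, ⟪Y n, w n - x⟫ := by
    intro x w hw
    have h1 := hy (x, w) hw
    rw [hyY] at h1
    have h2 := Fintype.sum_subtype_add_sum_subtype (fun k => f k x₀ < 0)
      (fun k => ρ k * (f k (w (Sum.inr k))).toReal)
    rw [← h2]
    refine h1.trans (le_of_eq ?_)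
    rw [add_assoc (∑ n : ι, _)]
    congr 3
    · exact Finset.sum_congr rfl fun k _ => by simp [ρ, k.2]
    · exact Finset.sum_congr rfl fun k _ => by rw [ha]; simp [ρ, k.2]
  -- The common variable is free. Moving it along a nonzero sum, by a step chosen so that the bound
  -- reads `v ≤ v - 1`, is a contradiction.
  have hsum : ∑ n, Y n = 0 := by
    by_contra hne
    have hpos : 0 < ⟪∑ n, Y n, ∑ n, Y n⟫ := real_inner_self_pos.2 hne
    set S := ∑ n, Y n
    set C := ∑ n : ι, (u n x₀).toReal + ∑ k, ρ k * (f k x₀).toReal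
    have h1 := main (x₀ + ((C - v + 1) / ⟪S, S⟫) • S) (fun _ => x₀) fun n => (hxh n).1
    have h2 : ∀ n, ⟪Y n, x₀ - (x₀ + ((C - v + 1) / ⟪S, S⟫) • S)⟫
        = -((C - v + 1) / ⟪S, S⟫) * ⟪Y n, S⟫ := by
      intro n
      rw [sub_add_cancel_left, inner_neg_right, real_inner_smul_right]; ring
    simp only [h2] at h1
    rw [← Finset.mul_sum, ← sum_inner, neg_mul, div_mul_cancel₀ _ hpos.ne'] at h1
    linarith
  refine ⟨ρ, fun n => -Y (Sum.inl n), fun k => -Y (Sum.inr k), hρ, ?_, fun w w' hw hw' => ?_⟩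
  · rw [Finset.sum_neg_distrib, Finset.sum_neg_distrib, ← neg_add, ← Fintype.sum_sum_type, hsum,
      neg_zero]
  · have h1 := main 0 (Sum.elim w w') (by rintro (n | k); exacts [hw n, hw' k])
    have h2 : ∑ n : N, ⟪Y n, (Sum.elim w w' : N → V) n - 0⟫
        = ∑ n, ⟪Y (Sum.inl n), w n⟫ + ∑ k, ⟪Y (Sum.inr k), w' k⟫ := by
      simp only [sub_zero]
      exact Fintype.sum_sum_type _
    rw [h2] at h1
    simp only [Sum.elim_inl, Sum.elim_inr] at h1
    simp only [inner_neg_left, Finset.sum_sub_distrib, Finset.sum_neg_distrib]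
    linarith

/-- Strong Fenchel–Lagrange duality under the Slater condition. -/
theorem exists_dual_solution {ι : Type*} [Fintype ι] {K : ℕ} {u : ι → V → EReal}
    {f : Fin K → V → EReal} (hu : ∀ n x, ⊥ < u n x) (hf : ∀ k x, ⊥ < f k x)
    (hcu : ∀ n, IsConvexFun (u n)) (hcf : ∀ k, IsConvexFun (f k)) {x₀ : V}
    (hxu : ∀ n, AlgRelInt (dom (u n)) x₀) (hxf : IsSlaterPoint f x₀) {v : ℝ}
    (hv : ∀ x, (∀ k, f k x ≤ 0) → (v : EReal) ≤ ∑ n, u n x) :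
    ∃ (τ : Fin K → ℝ) (y : ι → V) (ζ : Fin K → V) (b : ι → ℝ) (b' : Fin K → ℝ),
      (∀ k, 0 ≤ τ k) ∧ ∑ n, y n + ∑ k, ζ k = 0 ∧ (∀ n, conj (u n) (y n) ≤ b n) ∧
      (∀ k, persp (conj (f k)) (ζ k) (τ k) ≤ b' k) ∧ ∑ n, b n + ∑ k, b' k ≤ -v := by
  obtain ⟨τ, y, ζ, hτ, hsum, h⟩ := exists_split_multipliers hu hf hcu hcf hxu hxf hv
  have hxf' := fun k => algRelInt_of_mem_intrinsicInterior (hxf.2.1 k)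
  obtain ⟨b, hb, hbs⟩ := exists_upper_bounds (s := -v)
    (A := Sum.elim (fun n => (fun x => ⟪y n, x⟫ - (u n x).toReal) '' dom (u n))
      (fun k => (fun x => ⟪ζ k, x⟫ - τ k * (f k x).toReal) '' dom (f k)))
    (by rintro (n | k)
        exacts [⟨_, mem_image_of_mem _ (hxu n).1⟩, ⟨_, mem_image_of_mem _ (hxf' k).1⟩])
    (by
      intro a ha
      choose w hw hwa using fun n => ha (Sum.inl n)
      choose w' hw' hwa' using fun k => ha (Sum.inr k)
      have := h w w' hw hw'
      simp only at hwa hwa'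
      simpa only [Fintype.sum_sum_type, hwa, hwa'] using this)
  rw [Fintype.sum_sum_type] at hbs
  refine ⟨τ, y, ζ, fun n => b (Sum.inl n), fun k => b (Sum.inr k), hτ, hsum, fun n => ?_,
    fun k => ?_, hbs⟩
  · exact conj_le_coe (hu n) fun x hx => hb (Sum.inl n) _ (mem_image_of_mem _ hx)
  · obtain ⟨η, hη⟩ := exists_conj_lt_top (hf k) (hcf k) (hxf' k)
    exact persp_conj_le (hf k) hη (hτ k) fun x hx =>
      hb (Sum.inr k) _ (mem_image_of_mem (fun x => ⟪ζ k, x⟫ - τ k * (f k x).toReal) hx)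

end FenchelLagrange

namespace Problem

variable {m d I J K L : ℕ} (P : Problem m d I J K L)

/-! Transport plans moving the mass `q i j` from the atom `j` to the point `z i j`. -/

/-- `q i j` splits the mass of the atom `j`, and all destinations `z i j` are in the support set. -/
structure IsPlan (q : Fin I → Fin J → ℝ) (z : Fin I → Fin J → Vec d) : Prop where
  nonneg : ∀ i j, 0 ≤ q i j
  mass : ∀ j, ∑ i, q i j = P.prob j
  mem : ∀ i j, z i j ∈ P.supp

/-- The transportation cost of a plan. -/
noncomputable def planCost (q : Fin I → Fin J → ℝ) (z : Fin I → Fin J → Vec d) : ENNReal :=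
  ∑ i, ∑ j, ENNReal.ofReal (q i j) * P.cost (z i j) (P.atom j)

/-- The loss of a plan, where the mass `q i j` suffers the loss of the piece `i`. -/
noncomputable def planLoss (θ : Vec m) (q : Fin I → Fin J → ℝ) (z : Fin I → Fin J → Vec d) : ℝ :=
  ∑ i, ∑ j, q i j * P.piece i θ (z i j)

/-- The distribution generated by a plan. -/
noncomputable def planDist (q : Fin I → Fin J → ℝ) (z : Fin I → Fin J → Vec d) : Measure (Vec d) :=
  ∑ i, ∑ j, ENNReal.ofReal (q i j) • Measure.dirac (z i j)

theorem lintegral_sum_dirac {X : Type*} [MeasurableSpace X] [MeasurableSingletonClass X]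
    (q : Fin I → Fin J → ENNReal) (x : Fin I → Fin J → X) (g : X → ENNReal) :
    ∫⁻ w, g w ∂(∑ i, ∑ j, q i j • Measure.dirac (x i j)) = ∑ i, ∑ j, q i j * g (x i j) := by
  simp [lintegral_smul_measure, lintegral_dirac]

theorem piece_le_loss (i : Fin I) (θ : Vec m) (z : Vec d) : P.piece i θ z ≤ P.loss θ z :=
  le_ciSup (f := fun i => P.piece i θ z) (finite_range _).bddAbove i

theorem exists_loss_eq [NeZero I] (θ : Vec m) (z : Vec d) : ∃ i, P.piece i θ z = P.loss θ z :=
  exists_eq_ciSup_of_finite (f := fun i => P.piece i θ z)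

variable {P}

theorem continuous_piece_right (hconv : P.ConvexityConditions) (i : Fin I) (θ : Vec m) :
    Continuous (P.piece i θ) :=
  continuousOn_univ.1 ((hconv.piece_concave i θ).continuousOn isOpen_univ)

theorem continuous_piece_left (hconv : P.ConvexityConditions) (i : Fin I) (z : Vec d) :
    Continuous (fun θ => P.piece i θ z) :=
  continuousOn_univ.1 ((hconv.piece_convex i z).continuousOn isOpen_univ)

theorem measurable_loss (hconv : P.ConvexityConditions) (θ : Vec m) : Measurable (P.loss θ) :=
  Measurable.iSup fun i => (continuous_piece_right hconv i θ).measurable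

theorem measurable_cost (hconv : P.ConvexityConditions) :
    Measurable (fun w : Vec d × Vec d => P.cost w.1 w.2) :=
  hconv.cost_lsc.measurable

theorem cost_atom (hcost : P.CostIndiscernible) (href : P.DiscreteReference) (j : Fin J) :
    P.cost (P.atom j) (P.atom j) = 0 :=
  (hcost _ (href.2.2 j) _ (href.2.2 j)).2 rfl

theorem isClosed_feasSet {V : Type*} [NormedAddCommGroup V] [InnerProductSpace ℝ V] {N : ℕ}
    {h : Fin N → V → EReal} (hh : ∀ n, LowerSemicontinuous (h n)) : IsClosed (feasSet h) := by
  have : feasSet h = ⋂ n, h n ⁻¹' Iic 0 := by ext; simp [feasSet]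
  rw [this]
  exact isClosed_iInter fun n => (hh n).isClosed_preimage 0

theorem convex_feasSet {V : Type*} [NormedAddCommGroup V] [InnerProductSpace ℝ V] {N : ℕ}
    {h : Fin N → V → EReal} (hh : ∀ n, IsConvexFun (h n)) : Convex ℝ (feasSet h) := by
  intro x hx y hy a b ha hb hab n
  have := hh n (x := (x, 0)) (y := (y, 0)) (by simpa using hx n) (by simpa using hy n) ha hb hab
  simpa using this

theorem isClosed_supp (hconv : P.ConvexityConditions) : IsClosed P.supp :=
  isClosed_feasSet fun k => (hconv.supp_fun k).2.2

theorem convex_supp (hconv : P.ConvexityConditions) : Convex ℝ P.supp :=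
  convex_feasSet fun k => (hconv.supp_fun k).2.1

theorem IsPlan.sum_ofReal {q : Fin I → Fin J → ℝ} {z : Fin I → Fin J → Vec d} (h : P.IsPlan q z)
    (j : Fin J) : ∑ i, ENNReal.ofReal (q i j) = ENNReal.ofReal (P.prob j) := by
  rw [← ENNReal.ofReal_sum_of_nonneg fun i _ => h.nonneg i j, h.mass]

/-- The plan itself, viewed as a measure on pairs of destination and atom, is a coupling whose cost
is `planCost`. -/
theorem planDist_mem_ball (hconv : P.ConvexityConditions) (href : P.DiscreteReference)
    {q : Fin I → Fin J → ℝ} {z : Fin I → Fin J → Vec d}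
    (h : P.IsPlan q z) (hc : P.planCost q z ≤ ENNReal.ofReal P.eps) : planDist q z ∈ P.ball := by
  refine ⟨⟨?_⟩, ?_, ?_⟩
  · have : ∑ j, ENNReal.ofReal (P.prob j) = 1 := by
      rw [← ENNReal.ofReal_sum_of_nonneg fun j _ => (href.1 j).le, href.2.1, ENNReal.ofReal_one]
    simp only [planDist, Measure.coe_finsetSum, Finset.sum_apply, Measure.smul_apply,
      measure_univ, smul_eq_mul, mul_one]
    rw [Finset.sum_comm, Finset.sum_congr rfl fun j _ => h.sum_ofReal j, this]
  · have hm := (isClosed_supp hconv).measurableSet.compl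
    simp [planDist, Measure.dirac_apply' _ hm, h.mem]
  · let π : Measure (Vec d × Vec d) :=
      ∑ i, ∑ j, ENNReal.ofReal (q i j) • Measure.dirac (z i j, P.atom j)
    have hπ : π ∈ couplings (planDist q z) P.refDist := by
      constructor
      · simp only [π, planDist, Measure.map_finset_sum measurable_fst.aemeasurable,
          Measure.map_smul, Measure.map_dirac' measurable_fst]
      · simp only [π, refDist, Measure.map_finset_sum measurable_snd.aemeasurable,
          Measure.map_smul, Measure.map_dirac' measurable_snd]
        rw [Finset.sum_comm]
        refine Finset.sum_congr rfl fun j _ => ?_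
        rw [← Finset.sum_smul, h.sum_ofReal]
    refine (iInf₂_le π hπ).trans (le_trans (le_of_eq ?_) hc)
    exact lintegral_sum_dirac _ _ _

theorem coe_ennreal_ofReal_sub (a b : ℝ) :
    ((ENNReal.ofReal a : ENNReal) : EReal) - ((ENNReal.ofReal b : ENNReal) : EReal)
      = ((max a 0 - max b 0 : ℝ) : EReal) := by
  rw [EReal.coe_ennreal_ofReal, EReal.coe_ennreal_ofReal, EReal.coe_sub]

/-- Only an inequality, since a plan may charge mass for a piece that is not maximal at its
destination. It suffices, because plans serve only as lower bounds for the worst case. -/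
theorem planLoss_le_expect {q : Fin I → Fin J → ℝ}
    {z : Fin I → Fin J → Vec d} (hq : ∀ i j, 0 ≤ q i j) (θ : Vec m) :
    ((P.planLoss θ q z : ℝ) : EReal) ≤ expect (planDist q z) (P.loss θ) := by
  have h1 : ∀ g : Vec d → ℝ, ∫⁻ w, ENNReal.ofReal (g w) ∂(planDist q z)
      = ENNReal.ofReal (∑ i, ∑ j, q i j * max (g (z i j)) 0) := by
    intro g
    rw [planDist, lintegral_sum_dirac, ENNReal.ofReal_sum_of_nonneg fun i _ =>
      Finset.sum_nonneg fun j _ => mul_nonneg (hq i j) (le_max_right _ _)]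
    refine Finset.sum_congr rfl fun i _ => ?_
    rw [ENNReal.ofReal_sum_of_nonneg fun j _ => mul_nonneg (hq i j) (le_max_right _ _)]
    refine Finset.sum_congr rfl fun j _ => ?_
    rw [ENNReal.ofReal_mul (hq i j)]
    congr 1
    rcases le_total (g (z i j)) 0 with h0 | h0
    · rw [max_eq_right h0, ENNReal.ofReal_of_nonpos h0, ENNReal.ofReal_zero]
    · rw [max_eq_left h0]
  have h2 : ∀ g : Vec d → ℝ, 0 ≤ ∑ i, ∑ j, q i j * max (g (z i j)) 0 := fun g =>
    Finset.sum_nonneg fun i _ => Finset.sum_nonneg fun j _ =>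
      mul_nonneg (hq i j) (le_max_right _ _)
  rw [expect, h1, h1 (fun w => -P.loss θ w), coe_ennreal_ofReal_sub, max_eq_left (h2 _),
    max_eq_left (h2 fun w => -P.loss θ w), EReal.coe_le_coe_iff, ← Finset.sum_sub_distrib]
  refine Finset.sum_le_sum fun i _ => ?_
  rw [← Finset.sum_sub_distrib]
  refine Finset.sum_le_sum fun j _ => ?_
  rw [← mul_sub]
  refine mul_le_mul_of_nonneg_left ((P.piece_le_loss i θ (z i j)).trans (le_of_eq ?_)) (hq i j)
  rcases le_total (P.loss θ (z i j)) 0 with h0 | h0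
  · rw [max_eq_right h0, max_eq_left (by linarith)]; ring
  · rw [max_eq_left h0, max_eq_right (by linarith)]; ring

/-- Moving negative parts across keeps the hypothesis in `ENNReal`, free of `∞ - ∞`. An infinite
negative part gives expectation `⊥`; otherwise all four quantities are finite. -/
theorem expect_le_of_lintegral_le {X : Type*} [MeasurableSpace X] {Q : Measure X} {f : X → ℝ}
    {a b : ENNReal} {r : ℝ} (hb : b ≠ ⊤) (hr : (a : EReal) - (b : EReal) ≤ r)
    (h : ∫⁻ z, ENNReal.ofReal (f z) ∂Q + b ≤ ∫⁻ z, ENNReal.ofReal (-f z) ∂Q + a) :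
    expect Q f ≤ r := by
  unfold expect
  generalize ∫⁻ z, ENNReal.ofReal (f z) ∂Q = A at h ⊢
  generalize ∫⁻ z, ENNReal.ofReal (-f z) ∂Q = B at h ⊢
  by_cases hB : B = ⊤
  · subst hB; simp
  have ha : a ≠ ⊤ := by
    rintro rfl
    lift b to NNReal using hb
    have : (⊤ : EReal) ≤ r := le_trans (le_of_eq (by
      rw [EReal.coe_ennreal_top]
      exact (EReal.top_sub_coe (b : ℝ)).symm)) hr
    exact absurd this (not_le.2 (EReal.coe_lt_top r))
  have hA : A ≠ ⊤ := by
    rintro rfl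
    rw [top_add, top_le_iff] at h
    exact ENNReal.add_ne_top.2 ⟨hB, ha⟩ h
  lift A to NNReal using hA
  lift B to NNReal using hB
  lift a to NNReal using ha
  lift b to NNReal using hb
  have h1 : (A : ℝ) + b ≤ B + a := by exact_mod_cast h
  have h2 : (((a : ℝ) - b : ℝ) : EReal) ≤ r := hr
  have h3 : (((A : ℝ) - B : ℝ) : EReal) ≤ r :=
    EReal.coe_le_coe_iff.2 (by linarith [EReal.coe_le_coe_iff.1 h2])
  exact h3

/-- Weak duality for the worst-case expectation. -/
theorem expect_le_of_mem_ball (heps : 0 < P.eps) (hconv : P.ConvexityConditions)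
    (href : P.DiscreteReference) {Q : Measure (Vec d)} (hQ : Q ∈ P.ball) {θ : Vec m} {lam : ℝ}
    (hlam : 0 ≤ lam) {s : Fin J → ℝ}
    (hs : ∀ j, ∀ z ∈ P.supp, P.cost z (P.atom j) < ⊤ →
      P.loss θ z ≤ s j + lam * (P.cost z (P.atom j)).toReal) :
    expect Q (P.loss θ) ≤ ((lam * P.eps + ∑ j, P.prob j * s j : ℝ) : EReal) := by
  classical
  -- Atoms may coincide, so `s` need not be a function of the point; `S` takes the least `s j` among
  -- coinciding atoms. Off the atoms it is an empty infimum, hence `0`.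
  obtain ⟨S, hSm, hSle, hSeq⟩ : ∃ S : Vec d → ℝ, Measurable S ∧ (∀ j, S (P.atom j) ≤ s j) ∧
      ∀ j, ∃ j', P.atom j' = P.atom j ∧ S (P.atom j) = s j' := by
    refine ⟨fun w => ⨅ j : {j // P.atom j = w}, s j, ?_, fun j => ?_, fun j => ?_⟩
    · refine (measurable_zero (α := ℝ) (β := Vec d)).measurable_of_countable_ne ?_
      refine ((finite_range P.atom).subset ?_).countable
      intro w hw
      by_contra hw'
      have : IsEmpty {j // P.atom j = w} := ⟨fun j => hw' ⟨j, j.2⟩⟩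
      exact hw (by simp [Real.iInf_of_isEmpty])
    · exact ciInf_le (f := fun j' : {j' // P.atom j' = P.atom j} => s j')
        (finite_range _).bddBelow ⟨j, rfl⟩
    · have : Nonempty {j' // P.atom j' = P.atom j} := ⟨⟨j, rfl⟩⟩
      obtain ⟨j', hj'⟩ := exists_eq_ciInf_of_finite (f := fun j' : {j' // P.atom j' = P.atom j} => s j')
      exact ⟨j', j'.2, hj'.symm⟩
  obtain ⟨-, hQs, hQc⟩ := hQ
  refine EReal.le_of_forall_lt_iff_le.1 fun r hr => ?_
  have hr' : lam * P.eps + ∑ j, P.prob j * s j < r := by exact_mod_cast hr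
  -- The infimum over couplings need not be attained, so a coupling of cost below `eps + δ` is used.
  -- Dividing by `lam + 1` also covers `lam = 0`.
  obtain ⟨δ, hδ, hδr⟩ : ∃ δ : ℝ, 0 < δ ∧ lam * (P.eps + δ) + ∑ j, P.prob j * s j ≤ r := by
    refine ⟨(r - (lam * P.eps + ∑ j, P.prob j * s j)) / (lam + 1), div_pos (by linarith)
      (by linarith), ?_⟩
    have : lam * ((r - (lam * P.eps + ∑ j, P.prob j * s j)) / (lam + 1))
        ≤ r - (lam * P.eps + ∑ j, P.prob j * s j) := by
      rw [mul_div_assoc', div_le_iff₀ (by linarith)]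
      nlinarith
    linarith
  have h1 : otCost P.cost Q P.refDist < ENNReal.ofReal (P.eps + δ) :=
    hQc.trans_lt ((ENNReal.ofReal_lt_ofReal_iff (by linarith)).2 (by linarith))
  obtain ⟨π, h1⟩ := iInf_lt_iff.1 h1
  obtain ⟨⟨hπ₁, hπ₂⟩, hπc⟩ := iInf_lt_iff.1 h1
  have ae1 : ∀ᵐ w ∂π, w.1 ∈ P.supp := by
    have : ∀ᵐ z ∂(π.map Prod.fst), z ∈ P.supp := by rw [hπ₁]; exact hQs
    exact ae_of_ae_map measurable_fst.aemeasurable this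
  have ae2 : ∀ᵐ w ∂π, P.cost w.1 w.2 < ⊤ :=
    ae_lt_top (measurable_cost hconv) (hπc.trans ENNReal.ofReal_lt_top).ne
  have ae3 : ∀ᵐ w ∂π, w.2 ∈ range P.atom := by
    have : ∀ᵐ z ∂(π.map Prod.snd), z ∈ range P.atom := by
      rw [hπ₂, ae_iff, refDist]
      simp
    exact ae_of_ae_map measurable_snd.aemeasurable this
  have hle : ∀ᵐ w ∂π, ENNReal.ofReal (P.loss θ w.1) + ENNReal.ofReal (-S w.2)
      ≤ ENNReal.ofReal (-P.loss θ w.1) + (ENNReal.ofReal (S w.2)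
        + ENNReal.ofReal lam * P.cost w.1 w.2) := by
    filter_upwards [ae1, ae2, ae3] with w hw1 hw2 hw3
    obtain ⟨z, w⟩ := w
    obtain ⟨j, rfl⟩ := hw3
    obtain ⟨j', hj', hSj⟩ := hSeq j
    simp only at hw1 hw2 ⊢
    have h2 := hs j' z hw1 (by rw [hj']; exact hw2)
    rw [hj', ← hSj] at h2
    generalize S (P.atom j) = σ at h2 ⊢
    generalize P.loss θ z = ℓ at h2 ⊢
    generalize P.cost z (P.atom j) = c at h2 hw2 ⊢
    lift c to NNReal using hw2.ne
    rw [ENNReal.coe_toReal] at h2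
    rw [← ENNReal.ofReal_coe_nnreal, ← ENNReal.ofReal_mul hlam]
    have hc : 0 ≤ lam * c := mul_nonneg hlam c.2
    simp only [ENNReal.ofReal]
    norm_cast
    rw [← NNReal.coe_le_coe]
    push_cast
    simp only [Real.coe_toNNReal']
    rw [max_eq_left hc]
    have e1 : ∀ x : ℝ, max x 0 = max (-x) 0 + x := fun x => by
      rcases le_total x 0 with h0 | h0
      · rw [max_eq_right h0, max_eq_left (by linarith)]; ring
      · rw [max_eq_left h0, max_eq_right (by linarith)]; ring
    rw [e1 ℓ, e1 σ]
    linarith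
  have hmℓ := measurable_loss hconv θ
  have h3 := lintegral_mono_ae hle
  have m1 : Measurable fun w : Vec d × Vec d => ENNReal.ofReal (P.loss θ w.1) := by fun_prop
  have m2 : Measurable fun w : Vec d × Vec d => ENNReal.ofReal (-P.loss θ w.1) := by fun_prop
  have m3 : Measurable fun w : Vec d × Vec d => ENNReal.ofReal (S w.2) := by fun_prop
  rw [lintegral_add_left m1, lintegral_add_left m2, lintegral_add_left m3,
    lintegral_const_mul' _ _ ENNReal.ofReal_ne_top] at h3
  have hfst : ∀ g : Vec d → ENNReal, Measurable g → ∫⁻ w, g w.1 ∂π = ∫⁻ z, g z ∂Q := by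
    intro g hg
    rw [← hπ₁, lintegral_map hg measurable_fst]
  have hsnd : ∀ g : Vec d → ENNReal, Measurable g →
      ∫⁻ w, g w.2 ∂π = ∑ j, ENNReal.ofReal (P.prob j) * g (P.atom j) := by
    intro g hg
    rw [← lintegral_map hg measurable_snd, hπ₂, refDist]
    simp [lintegral_smul_measure, lintegral_dirac]
  have hsum : ∀ g : Vec d → ℝ, ∑ j, ENNReal.ofReal (P.prob j) * ENNReal.ofReal (g (P.atom j))
      = ENNReal.ofReal (∑ j, P.prob j * max (g (P.atom j)) 0) := by
    intro g
    rw [ENNReal.ofReal_sum_of_nonneg fun j _ => mul_nonneg (href.1 j).le (le_max_right _ _)]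
    refine Finset.sum_congr rfl fun j _ => ?_
    rw [ENNReal.ofReal_mul (href.1 j).le]
    congr 1
    rcases le_total (g (P.atom j)) 0 with h0 | h0
    · rw [max_eq_right h0, ENNReal.ofReal_of_nonpos h0, ENNReal.ofReal_zero]
    · rw [max_eq_left h0]
  rw [hfst _ hmℓ.ennreal_ofReal, hfst (fun z => ENNReal.ofReal (-P.loss θ z)) hmℓ.neg.ennreal_ofReal,
    hsnd _ hSm.ennreal_ofReal, hsnd (fun z => ENNReal.ofReal (-S z)) hSm.neg.ennreal_ofReal, hsum,
    hsum (fun z => - S z)] at h3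
  have h4 := h3.trans (add_le_add_right (add_le_add_right (mul_le_mul_right hπc.le _) _) _)
  have hp : ∀ g : Vec d → ℝ, 0 ≤ ∑ j, P.prob j * max (g (P.atom j)) 0 := fun g =>
    Finset.sum_nonneg fun j _ => mul_nonneg (href.1 j).le (le_max_right _ _)
  have hpos : 0 ≤ lam * (P.eps + δ) := mul_nonneg hlam (by linarith)
  rw [← ENNReal.ofReal_mul hlam, ← ENNReal.ofReal_add (hp S) hpos] at h4
  refine expect_le_of_lintegral_le ENNReal.ofReal_ne_top ?_ h4
  rw [coe_ennreal_ofReal_sub, max_eq_left (add_nonneg (hp S) hpos),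
    max_eq_left (hp fun w => -S w), EReal.coe_le_coe_iff]
  have h5 : ∑ j, P.prob j * max (S (P.atom j)) 0 - ∑ j, P.prob j * max (-S (P.atom j)) 0
      ≤ ∑ j, P.prob j * s j := by
    rw [← Finset.sum_sub_distrib]
    refine Finset.sum_le_sum fun j _ => ?_
    rw [← mul_sub]
    refine mul_le_mul_of_nonneg_left (le_trans (le_of_eq ?_) (hSle j)) (href.1 j).le
    rcases le_total (S (P.atom j)) 0 with h0 | h0
    · rw [max_eq_right h0, max_eq_left (by linarith)]; ring
    · rw [max_eq_left h0, max_eq_right (by linarith)]; ring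
  linarith

/-! ### Merging plans, and strong duality for the worst case -/

theorem cost_combo_le (hconv : P.ConvexityConditions) {z' : Vec d} (hz' : z' ∈ P.supp) (x y : Vec d)
    {a b : ℝ} (ha : 0 ≤ a) (hb : 0 ≤ b) (hab : a + b = 1) :
    P.cost (a • x + b • y) z'
      ≤ ENNReal.ofReal a * P.cost x z' + ENNReal.ofReal b * P.cost y z' := by
  rcases ha.eq_or_lt with rfl | ha'
  · obtain rfl : b = 1 := by linarith
    simp
  rcases hb.eq_or_lt with rfl | hb'
  · obtain rfl : a = 1 := by linarith
    simp
  by_cases hx : P.cost x z' = ⊤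
  · rw [hx, ENNReal.mul_top (by simpa using ha')]; simp
  by_cases hy : P.cost y z' = ⊤
  · rw [hy, ENNReal.mul_top (by simpa using hb')]; simp
  have hrep : ∀ {c : ENNReal}, c ≠ ⊤ → (c : EReal) ≤ ((c.toReal : ℝ) : EReal) := by
    intro c hc
    lift c to NNReal using hc
    exact le_rfl
  have h := hconv.cost_convex z' hz' (x := (x, (P.cost x z').toReal))
    (y := (y, (P.cost y z').toReal)) (hrep hx) (hrep hy) ha hb hab
  have h1 : ((P.cost (a • x + b • y) z' : ENNReal) : EReal)
      ≤ ((a * (P.cost x z').toReal + b * (P.cost y z').toReal : ℝ) : EReal) := h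
  generalize P.cost (a • x + b • y) z' = c at h1 ⊢
  lift P.cost x z' to NNReal using hx with cx
  lift P.cost y z' to NNReal using hy with cy
  have hc : c ≠ ⊤ := by
    rintro rfl
    exact absurd h1 (not_le.2 (EReal.coe_lt_top _))
  lift c to NNReal using hc
  have h2 : (c : ℝ) ≤ a * cx + b * cy := EReal.coe_le_coe_iff.1 h1
  rw [← ENNReal.ofReal_coe_nnreal, ← ENNReal.ofReal_coe_nnreal, ← ENNReal.ofReal_coe_nnreal,
    ← ENNReal.ofReal_mul ha, ← ENNReal.ofReal_mul hb,
    ← ENNReal.ofReal_add (mul_nonneg ha cx.coe_nonneg) (mul_nonneg hb cy.coe_nonneg)]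
  exact ENNReal.ofReal_le_ofReal h2

/-- The barycenter of two masses does not increase convex costs or decrease concave rewards. -/
theorem exists_barycenter {E : Type*} [AddCommGroup E] [Module ℝ E] {Z : Set E} (hZ : Convex ℝ Z)
    {c : E → ENNReal} (hc : ∀ x y : E, ∀ a b : ℝ, 0 ≤ a → 0 ≤ b → a + b = 1 →
      c (a • x + b • y) ≤ ENNReal.ofReal a * c x + ENNReal.ofReal b * c y)
    {x y : E} (hx : x ∈ Z) (hy : y ∈ Z) {α β : ℝ} (hα : 0 ≤ α) (hβ : 0 ≤ β) :
    ∃ z ∈ Z, ENNReal.ofReal (α + β) * c z ≤ ENNReal.ofReal α * c x + ENNReal.ofReal β * c y ∧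
      ∀ φ : E → ℝ, ConcaveOn ℝ univ φ → α * φ x + β * φ y ≤ (α + β) * φ z := by
  rcases (add_nonneg hα hβ).eq_or_lt with h0 | h0
  · refine ⟨x, hx, by simp [← h0], fun φ _ => ?_⟩
    obtain rfl : α = 0 := by linarith
    obtain rfl : β = 0 := by linarith
    simp
  have ha : 0 ≤ α / (α + β) := div_nonneg hα h0.le
  have hb : 0 ≤ β / (α + β) := div_nonneg hβ h0.le
  have hab : α / (α + β) + β / (α + β) = 1 := by field_simp
  have e1 : (α + β) * (α / (α + β)) = α := by field_simp
  have e2 : (α + β) * (β / (α + β)) = β := by field_simp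
  refine ⟨_, hZ hx hy ha hb hab, ?_, fun φ hφ => ?_⟩
  · refine (mul_le_mul_right (hc x y _ _ ha hb hab) _).trans (le_of_eq ?_)
    rw [mul_add, ← mul_assoc, ← mul_assoc, ← ENNReal.ofReal_mul h0.le, ← ENNReal.ofReal_mul h0.le,
      e1, e2]
  · have := mul_le_mul_of_nonneg_left (hφ.2 (mem_univ x) (mem_univ y) ha hb hab) h0.le
    rw [smul_eq_mul, smul_eq_mul, mul_add, ← mul_assoc, ← mul_assoc, e1, e2] at this
    exact this

/-- For each `(i, j)` the two scaled masses are merged at their barycenter. That point does not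
depend on `θ`, so a single plan dominates the mixture for all decisions. -/
theorem exists_plan_combo (hconv : P.ConvexityConditions) (href : P.DiscreteReference)
    {q₁ q₂ : Fin I → Fin J → ℝ} {z₁ z₂ : Fin I → Fin J → Vec d} (h₁ : P.IsPlan q₁ z₁)
    (h₂ : P.IsPlan q₂ z₂) {a b : ℝ} (ha : 0 ≤ a) (hb : 0 ≤ b) (hab : a + b = 1) :
    ∃ q z, P.IsPlan q z ∧
      P.planCost q z ≤ ENNReal.ofReal a * P.planCost q₁ z₁ + ENNReal.ofReal b * P.planCost q₂ z₂ ∧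
      ∀ θ, a * P.planLoss θ q₁ z₁ + b * P.planLoss θ q₂ z₂ ≤ P.planLoss θ q z := by
  have hex := fun i j => exists_barycenter (convex_supp hconv)
    (c := fun z => P.cost z (P.atom j)) (fun x y a b ha hb hab =>
      cost_combo_le hconv (href.2.2 j) x y ha hb hab) (h₁.mem i j) (h₂.mem i j)
    (mul_nonneg ha (h₁.nonneg i j)) (mul_nonneg hb (h₂.nonneg i j))
  choose z hz hzc hzl using hex
  refine ⟨fun i j => a * q₁ i j + b * q₂ i j, z, ⟨fun i j => ?_, fun j => ?_, hz⟩, ?_, fun θ => ?_⟩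
  · exact add_nonneg (mul_nonneg ha (h₁.nonneg i j)) (mul_nonneg hb (h₂.nonneg i j))
  · rw [Finset.sum_add_distrib, ← Finset.mul_sum, ← Finset.mul_sum, h₁.mass, h₂.mass, ← add_mul, hab,
      one_mul]
  · simp only [planCost, Finset.mul_sum, ← Finset.sum_add_distrib]
    refine Finset.sum_le_sum fun i _ => Finset.sum_le_sum fun j _ => (hzc i j).trans (le_of_eq ?_)
    rw [ENNReal.ofReal_mul ha, ENNReal.ofReal_mul hb, mul_assoc, mul_assoc]
  · simp only [planLoss, Finset.mul_sum, ← Finset.sum_add_distrib]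
    refine Finset.sum_le_sum fun i _ => Finset.sum_le_sum fun j _ => ?_
    refine (le_of_eq ?_).trans (hzl i j _ (hconv.piece_concave i θ))
    ring

variable (P) in
/-- The plans within the budget. -/
def plans : Set ((Fin I → Fin J → ℝ) × (Fin I → Fin J → Vec d)) :=
  {y | P.IsPlan y.1 y.2 ∧ P.planCost y.1 y.2 ≤ ENNReal.ofReal P.eps}

theorem exists_mem_plans_combo (hconv : P.ConvexityConditions) (href : P.DiscreteReference)
    {y₁ y₂ : (Fin I → Fin J → ℝ) × (Fin I → Fin J → Vec d)} (h₁ : y₁ ∈ P.plans) (h₂ : y₂ ∈ P.plans)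
    {a b : ℝ} (ha : 0 ≤ a) (hb : 0 ≤ b) (hab : a + b = 1) :
    ∃ y ∈ P.plans, ∀ θ, a * P.planLoss θ y₁.1 y₁.2 + b * P.planLoss θ y₂.1 y₂.2
      ≤ P.planLoss θ y.1 y.2 := by
  obtain ⟨q, z, hp, hc, hl⟩ := exists_plan_combo hconv href h₁.1 h₂.1 ha hb hab
  refine ⟨(q, z), ⟨hp, hc.trans ?_⟩, hl⟩
  calc _ ≤ ENNReal.ofReal a * ENNReal.ofReal P.eps + ENNReal.ofReal b * ENNReal.ofReal P.eps :=
        add_le_add (mul_le_mul_right h₁.2 _) (mul_le_mul_right h₂.2 _)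
    _ = ENNReal.ofReal P.eps := by
        rw [← add_mul, ← ENNReal.ofReal_add ha hb, hab, ENNReal.ofReal_one, one_mul]

variable (P) in
/-- The masses of the plan that moves all mass of the atom `j` under the piece `σ j`. -/
def selMass (σ : Fin J → Fin I) (i : Fin I) (j : Fin J) : ℝ := if i = σ j then P.prob j else 0

theorem isPlan_selMass (href : P.DiscreteReference) (σ : Fin J → Fin I) {w : Fin J → Vec d}
    (hw : ∀ j, w j ∈ P.supp) : P.IsPlan (P.selMass σ) (fun _ => w) where
  nonneg i j := by
    unfold selMass
    split_ifs
    exacts [(href.1 j).le, le_rfl]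
  mass j := by simp [selMass]
  mem _ := hw

theorem planCost_selMass (σ : Fin J → Fin I) (w : Fin J → Vec d) :
    P.planCost (P.selMass σ) (fun _ => w)
      = ∑ j, ENNReal.ofReal (P.prob j) * P.cost (w j) (P.atom j) := by
  rw [planCost, Finset.sum_comm]
  refine Finset.sum_congr rfl fun j _ => ?_
  rw [Finset.sum_eq_single (σ j) (fun i _ hi => by simp [selMass, hi]) (by simp)]
  simp [selMass]

theorem planLoss_selMass (θ : Vec m) (σ : Fin J → Fin I) (w : Fin J → Vec d) :
    P.planLoss θ (P.selMass σ) (fun _ => w) = ∑ j, P.prob j * P.piece (σ j) θ (w j) := by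
  rw [planLoss, Finset.sum_comm]
  refine Finset.sum_congr rfl fun j _ => ?_
  rw [Finset.sum_eq_single (σ j) (fun i _ hi => by simp [selMass, hi]) (by simp)]
  simp [selMass]

theorem selMass_atom_mem_plans (hcost : P.CostIndiscernible) (href : P.DiscreteReference)
    (σ : Fin J → Fin I) : (P.selMass σ, fun _ => P.atom) ∈ P.plans := by
  refine ⟨isPlan_selMass href σ href.2.2, ?_⟩
  simp only [planCost_selMass, cost_atom hcost href]
  simp

/-- Strong duality for the worst case over plans. -/
theorem exists_multiplier_of_planLoss_le [NeZero I] (heps : 0 < P.eps) (hcost : P.CostIndiscernible)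
    (href : P.DiscreteReference) (hconv : P.ConvexityConditions) {θ : Vec m} {v : ℝ}
    (hv : ∀ y ∈ P.plans, P.planLoss θ y.1 y.2 ≤ v) :
    ∃ (lam : ℝ) (s : Fin J → ℝ), 0 ≤ lam ∧ lam * P.eps + ∑ j, P.prob j * s j ≤ v ∧
      ∀ i j, ∀ z ∈ P.supp, P.cost z (P.atom j) < ⊤ →
        P.piece i θ z ≤ s j + lam * (P.cost z (P.atom j)).toReal := by
  -- Pairs of a budget and a loss achievable within it. Merging makes this set convex, and budget
  -- `0`, with all mass left at the atoms, is strictly below `eps`.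
  let S : Set (ℝ × ℝ) := {p | 0 ≤ p.1 ∧ ∃ q z, P.IsPlan q z ∧
    P.planCost q z ≤ ENNReal.ofReal p.1 ∧ p.2 ≤ P.planLoss θ q z}
  have hS : Convex ℝ S := by
    rintro p ⟨hp, q₁, z₁, h₁, hc₁, hl₁⟩ r ⟨hr, q₂, z₂, h₂, hc₂, hl₂⟩ a b ha hb hab
    obtain ⟨q, z, h, hc, hl⟩ := exists_plan_combo hconv href h₁ h₂ ha hb hab
    refine ⟨add_nonneg (mul_nonneg ha hp) (mul_nonneg hb hr), q, z, h, hc.trans ?_, le_trans ?_ (hl θ)⟩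
    · refine (add_le_add (mul_le_mul_right hc₁ _) (mul_le_mul_right hc₂ _)).trans (le_of_eq ?_)
      rw [← ENNReal.ofReal_mul ha, ← ENNReal.ofReal_mul hb,
        ← ENNReal.ofReal_add (mul_nonneg ha hp) (mul_nonneg hb hr)]
      rfl
    · exact add_le_add (mul_le_mul_of_nonneg_left hl₁ ha) (mul_le_mul_of_nonneg_left hl₂ hb)
  have hG : ConvexOn ℝ S (fun p => -p.2) :=
    ⟨hS, fun p _ r _ a b _ _ _ => le_of_eq (by simp; ring)⟩
  have hh : ConvexOn ℝ S (fun p => p.1 - P.eps) :=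
    ⟨hS, fun p _ r _ a b _ _ hab => le_of_eq (by
      simp only [Prod.fst_add, Prod.smul_fst, smul_eq_mul]
      linear_combination P.eps * hab)⟩
  let σ₀ : Fin J → Fin I := fun _ => 0
  obtain ⟨lam, hlam, hl⟩ := exists_multiplier_of_slater hG hh (v := -v)
    (x₀ := ((0 : ℝ), P.planLoss θ (P.selMass σ₀) fun _ => P.atom))
    ⟨le_rfl, _, _, isPlan_selMass href σ₀ href.2.2, by
      simp [planCost_selMass, cost_atom hcost href], le_rfl⟩ (by simpa using heps)
    (by
      rintro ⟨u, w⟩ ⟨-, q, z, h, hc, hl⟩ hu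
      have := hv (q, z) ⟨h, hc.trans (ENNReal.ofReal_le_ofReal (by simpa using hu))⟩
      simp only at this hl ⊢
      linarith)
  -- The Lagrangian bound is tested on plans sending each whole atom to one point under one piece.
  -- The choices for different atoms are independent, so the bound splits over `j`; dividing by
  -- `prob j` gives `s j`.
  obtain ⟨b, hb, hbs⟩ := exists_upper_bounds (s := v - lam * P.eps)
    (A := fun j => {r | ∃ i, ∃ z ∈ P.supp, P.cost z (P.atom j) < ⊤ ∧
      r = P.prob j * (P.piece i θ z - lam * (P.cost z (P.atom j)).toReal)})
    (fun j => ⟨_, 0, P.atom j, href.2.2 j, by rw [cost_atom hcost href]; simp, rfl⟩)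
    (by
      intro r hr
      choose σ w hw hc hrw using hr
      have h1 := hl (∑ j, P.prob j * (P.cost (w j) (P.atom j)).toReal,
        ∑ j, P.prob j * P.piece (σ j) θ (w j)) ⟨by
          dsimp only
          exact Finset.sum_nonneg fun j _ => mul_nonneg (href.1 j).le ENNReal.toReal_nonneg,
          P.selMass σ, fun _ => w,
          isPlan_selMass href σ hw, by
            rw [planCost_selMass, ENNReal.ofReal_sum_of_nonneg fun j _ =>
              mul_nonneg (href.1 j).le ENNReal.toReal_nonneg]
            refine Finset.sum_le_sum fun j _ => ?_
            rw [ENNReal.ofReal_mul (href.1 j).le, ENNReal.ofReal_toReal (hc j).ne],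
          by rw [planLoss_selMass]⟩
      have h2 : ∑ j, r j = ∑ j, P.prob j * P.piece (σ j) θ (w j)
          - lam * ∑ j, P.prob j * (P.cost (w j) (P.atom j)).toReal := by
        rw [Finset.mul_sum, ← Finset.sum_sub_distrib]
        exact Finset.sum_congr rfl fun j _ => by rw [hrw]; ring
      simp only at h1
      linarith)
  refine ⟨lam, fun j => b j / P.prob j, hlam, ?_, fun i j z hz hc => ?_⟩
  · have : ∑ j, P.prob j * (b j / P.prob j) = ∑ j, b j :=
      Finset.sum_congr rfl fun j _ => mul_div_cancel₀ _ (href.1 j).ne'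
    linarith
  · have := hb j _ ⟨i, z, hz, hc, rfl⟩
    rw [mul_comm, ← le_div_iff₀ (href.1 j)] at this
    linarith

theorem planLoss_le_worstCase (hconv : P.ConvexityConditions) (href : P.DiscreteReference)
    {y : (Fin I → Fin J → ℝ) × (Fin I → Fin J → Vec d)} (hy : y ∈ P.plans) (θ : Vec m) :
    ((P.planLoss θ y.1 y.2 : ℝ) : EReal) ≤ P.worstCase θ :=
  (planLoss_le_expect hy.1.nonneg θ).trans
    (le_iSup₂ (f := fun Q (_ : Q ∈ P.ball) => expect Q (P.loss θ)) _
      (planDist_mem_ball hconv href hy.1 hy.2))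

theorem worstCase_le_of_multiplier [NeZero I] (heps : 0 < P.eps) (hconv : P.ConvexityConditions)
    (href : P.DiscreteReference) {θ : Vec m} {lam : ℝ} (hlam : 0 ≤ lam) {s : Fin J → ℝ}
    (hs : ∀ i j, ∀ z ∈ P.supp, P.cost z (P.atom j) < ⊤ →
      P.piece i θ z ≤ s j + lam * (P.cost z (P.atom j)).toReal) :
    P.worstCase θ ≤ ((lam * P.eps + ∑ j, P.prob j * s j : ℝ) : EReal) := by
  refine iSup₂_le fun Q hQ => expect_le_of_mem_ball heps hconv href hQ hlam fun j z hz hc => ?_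
  obtain ⟨i, hi⟩ := P.exists_loss_eq θ z
  exact hi ▸ hs i j z hz hc

/-- No distribution in the ball beats the plans: a bound on plans yields multipliers, and these
bound every expectation. -/
theorem worstCase_le_of_planLoss_le [NeZero I] (heps : 0 < P.eps) (hcost : P.CostIndiscernible)
    (href : P.DiscreteReference) (hconv : P.ConvexityConditions) {θ : Vec m} {v : ℝ}
    (hv : ∀ y ∈ P.plans, P.planLoss θ y.1 y.2 ≤ v) : P.worstCase θ ≤ v := by
  obtain ⟨lam, s, hlam, hle, hs⟩ := exists_multiplier_of_planLoss_le heps hcost href hconv hv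
  exact (worstCase_le_of_multiplier heps hconv href hlam hs).trans (EReal.coe_le_coe_iff.2 hle)

end Problem

/-- A theorem of alternatives: a convex set that misses the open negative orthant lies in a half-space
with a nonnegative normal vector. -/
theorem exists_weights_of_forall_exists_nonneg {ι : Type*} [Fintype ι] {S : Set (ι → ℝ)}
    (hS : Convex ℝ S) (hne : S.Nonempty) (h : ∀ ρ ∈ S, ∃ i, 0 ≤ ρ i) :
    ∃ w : ι → ℝ, (∀ i, 0 ≤ w i) ∧ ∑ i, w i = 1 ∧ ∀ ρ ∈ S, 0 ≤ ∑ i, w i * ρ i := by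
  obtain ⟨ρ₀, hρ₀⟩ := hne
  let D : Set ((ι → ℝ) × ℝ) := {p | p.1 ∈ S}
  have hD : Convex ℝ D := fun p hp q hq a b ha hb hab => hS hp hq ha hb hab
  -- Minimize `t` subject to `ρ i ≤ t`, whose value is nonnegative by assumption. Since `t` is free,
  -- its coefficient `1 - ∑ w` must vanish.
  obtain ⟨w, hw, hw'⟩ := exists_multipliers_of_slater (D := D) (x₀ := (ρ₀, ∑ i, |ρ₀ i| + 1)) hρ₀
    (v := 0) (h := fun i p => p.1 i - p.2) Finset.univ (G := fun p => p.2)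
    ⟨hD, fun p _ q _ a b _ _ _ => le_rfl⟩
    (fun i _ => ⟨hD, fun p _ q _ a b _ _ _ => le_of_eq (by simp; ring)⟩)
    (fun i _ => by
      have h1 := Finset.single_le_sum (f := fun i => |ρ₀ i|) (fun i _ => abs_nonneg _)
        (Finset.mem_univ i)
      have h2 := le_abs_self (ρ₀ i)
      simp only at h1 ⊢
      linarith)
    (fun p hp hp' => by
      obtain ⟨i, hi⟩ := h p.1 hp
      have := hp' i (Finset.mem_univ i)
      linarith)
  have key : ∀ ρ ∈ S, ∀ t : ℝ, 0 ≤ t * (1 - ∑ i, w i) + ∑ i, w i * ρ i := by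
    intro ρ hρ t
    have := hw' (ρ, t) hρ
    simp only [mul_sub, Finset.sum_sub_distrib, ← Finset.sum_mul] at this
    linarith
  have hsum : ∑ i, w i = 1 := by
    by_contra hne
    have h1 : 1 - ∑ i, w i ≠ 0 := sub_ne_zero.2 (Ne.symm hne)
    have := key ρ₀ hρ₀ ((-∑ i, w i * ρ₀ i - 1) / (1 - ∑ i, w i))
    rw [div_mul_cancel₀ _ h1] at this
    linarith
  refine ⟨w, hw, hsum, fun ρ hρ => ?_⟩
  simpa [hsum] using key ρ hρ 0

/-! ### The minimax theorem for decisions and plans -/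

namespace Problem

variable {m d I J K L : ℕ} {P : Problem m d I J K L}

theorem isClosed_feas (hconv : P.ConvexityConditions) : IsClosed P.feas :=
  isClosed_feasSet fun l => (hconv.feas_fun l).2.2

theorem convex_feas (hconv : P.ConvexityConditions) : Convex ℝ P.feas :=
  convex_feasSet fun l => (hconv.feas_fun l).2.1

theorem convexOn_planLoss (hconv : P.ConvexityConditions) {q : Fin I → Fin J → ℝ}
    {z : Fin I → Fin J → Vec d} (hq : ∀ i j, 0 ≤ q i j) :
    ConvexOn ℝ univ (fun θ => P.planLoss θ q z) := by
  refine ⟨convex_univ, fun x _ y _ a b ha hb hab => ?_⟩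
  simp only [planLoss, smul_eq_mul, Finset.mul_sum, ← Finset.sum_add_distrib]
  refine Finset.sum_le_sum fun i _ => Finset.sum_le_sum fun j _ => ?_
  have := mul_le_mul_of_nonneg_left
    ((hconv.piece_convex i (z i j)).2 (mem_univ x) (mem_univ y) ha hb hab) (hq i j)
  simp only [smul_eq_mul] at this
  linarith

theorem continuous_planLoss (hconv : P.ConvexityConditions) (q : Fin I → Fin J → ℝ)
    (z : Fin I → Fin J → Vec d) : Continuous (fun θ => P.planLoss θ q z) :=
  continuous_finsetSum _ fun i _ => continuous_finsetSum _ fun j _ =>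
    continuous_const.mul (continuous_piece_left hconv i (z i j))

theorem convex_setOf_le_planLoss (hconv : P.ConvexityConditions) (href : P.DiscreteReference) :
    Convex ℝ {g : Vec m → ℝ | ∃ y ∈ P.plans, ∀ θ, g θ ≤ P.planLoss θ y.1 y.2} := by
  rintro g₁ ⟨y₁, hy₁, hg₁⟩ g₂ ⟨y₂, hy₂, hg₂⟩ a b ha hb hab
  obtain ⟨y, hy, hl⟩ := exists_mem_plans_combo hconv href hy₁ hy₂ ha hb hab
  refine ⟨y, hy, fun θ => le_trans ?_ (hl θ)⟩
  exact add_le_add (mul_le_mul_of_nonneg_left (hg₁ θ) ha) (mul_le_mul_of_nonneg_left (hg₂ θ) hb)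

/-- If finitely many plans defeat all feasible decisions, then so does a single plan. -/
theorem exists_plan_of_finset (hconv : P.ConvexityConditions) (href : P.DiscreteReference)
    (hne : P.feas.Nonempty) {r : ℝ} (F : Finset P.plans)
    (hF : ∀ θ ∈ P.feas, ∃ y ∈ F, r ≤ P.planLoss θ y.1.1 y.1.2) :
    ∃ y ∈ P.plans, ∀ θ ∈ P.feas, r ≤ P.planLoss θ y.1 y.2 := by
  obtain ⟨w, hw, hw1, hwS⟩ := exists_weights_of_forall_exists_nonneg
    (S := {ρ : F → ℝ | ∃ θ ∈ P.feas, ∀ y : F, P.planLoss θ y.1.1.1 y.1.1.2 - r ≤ ρ y}) (by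
      rintro ρ₁ ⟨θ₁, h₁, hl₁⟩ ρ₂ ⟨θ₂, h₂, hl₂⟩ a b ha hb hab
      refine ⟨_, convex_feas hconv h₁ h₂ ha hb hab, fun y => ?_⟩
      have h1 := (convexOn_planLoss hconv (z := y.1.1.2) y.1.2.1.nonneg).2
        (mem_univ θ₁) (mem_univ θ₂) ha hb hab
      have h2 := mul_le_mul_of_nonneg_left (hl₁ y) ha
      have h3 := mul_le_mul_of_nonneg_left (hl₂ y) hb
      simp only [smul_eq_mul, Pi.add_apply, Pi.smul_apply] at h1 ⊢
      have h4 : r = a * r + b * r := by rw [← add_mul, hab, one_mul]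
      linarith)
    (by
      obtain ⟨θ, hθ⟩ := hne
      exact ⟨_, θ, hθ, fun y => le_rfl⟩)
    (by
      rintro ρ ⟨θ, hθ, hl⟩
      obtain ⟨y, hy, hr⟩ := hF θ hθ
      exact ⟨⟨y, hy⟩, by linarith [hl ⟨y, hy⟩]⟩)
  obtain ⟨y, hy, hl⟩ := (convex_setOf_le_planLoss hconv href).sum_mem (t := Finset.univ)
    (fun i _ => hw i) hw1 (z := fun (y : F) θ => P.planLoss θ y.1.1.1 y.1.1.2)
    (fun y _ => ⟨y.1.1, y.1.2, fun θ => le_rfl⟩)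
  refine ⟨y, hy, fun θ hθ => le_trans ?_ (hl θ)⟩
  have h1 := hwS _ ⟨θ, hθ, fun y => le_rfl⟩
  simp only [mul_sub, Finset.sum_sub_distrib, ← Finset.sum_mul, hw1] at h1
  simp only [Finset.sum_apply, Pi.smul_apply, smul_eq_mul]
  linarith

/-- If every feasible decision is defeated by some plan, then finitely many feasible decisions are
defeated by a single plan. -/
theorem exists_plan_of_finset_feas (hconv : P.ConvexityConditions) (href : P.DiscreteReference)
    (hne : P.plans.Nonempty) {r : ℝ} (H : ∀ θ ∈ P.feas, ∃ y ∈ P.plans, r < P.planLoss θ y.1 y.2)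
    (F : Finset P.feas) : ∃ y ∈ P.plans, ∀ θ ∈ F, r ≤ P.planLoss θ y.1 y.2 := by
  by_contra! hno
  obtain ⟨w, hw, hw1, hwS⟩ := exists_weights_of_forall_exists_nonneg
    (S := {ρ : F → ℝ | ∃ y ∈ P.plans, ∀ θ : F, r - P.planLoss θ.1 y.1 y.2 ≤ ρ θ}) (by
      rintro ρ₁ ⟨y₁, h₁, hl₁⟩ ρ₂ ⟨y₂, h₂, hl₂⟩ a b ha hb hab
      obtain ⟨y, hy, hl⟩ := exists_mem_plans_combo hconv href h₁ h₂ ha hb hab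
      refine ⟨y, hy, fun θ => ?_⟩
      have h2 := mul_le_mul_of_nonneg_left (hl₁ θ) ha
      have h3 := mul_le_mul_of_nonneg_left (hl₂ θ) hb
      simp only [smul_eq_mul, Pi.add_apply, Pi.smul_apply]
      have h4 : r = a * r + b * r := by rw [← add_mul, hab, one_mul]
      linarith [hl θ.1])
    (by
      obtain ⟨y, hy⟩ := hne
      exact ⟨_, y, hy, fun θ => le_rfl⟩)
    (by
      rintro ρ ⟨y, hy, hl⟩
      obtain ⟨θ, hθ, hr⟩ := hno y hy
      exact ⟨⟨θ, hθ⟩, by linarith [hl ⟨θ, hθ⟩]⟩)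
  obtain ⟨y, hy, hr⟩ := H _ ((convex_feas hconv).sum_mem (t := Finset.univ) (fun i _ => hw i) hw1
    (z := fun θ : F => (θ.1 : Vec m)) (fun θ _ => θ.1.2))
  have h1 := (convexOn_planLoss hconv (z := y.2) hy.1.nonneg).map_sum_le (t := Finset.univ)
    (fun i _ => hw i) hw1 (p := fun θ : F => (θ.1 : Vec m)) (fun θ _ => mem_univ _)
  have h2 := hwS _ ⟨y, hy, fun θ => le_rfl⟩
  simp only [mul_sub, Finset.sum_sub_distrib, ← Finset.sum_mul, hw1] at h2
  simp only [smul_eq_mul] at h1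
  linarith

/-- Inside a large ball, compactness gives finitely many plans that defeat all decisions at level
`r`. Finitely many more exceed a higher level `ρ` on the bounding sphere, and convexity along rays
from `θ₁` carries this outwards. The distribution `Q` enters only through `expect Q ≤ worstCase`. -/
theorem exists_plan_of_infCompact [NeZero I] (heps : 0 < P.eps) (hcost : P.CostIndiscernible)
    (href : P.DiscreteReference) (hconv : P.ConvexityConditions) (hfin : P.WorstCaseFinite)
    (hcpt : P.InfCompact) {r : ℝ}
    (H : ∀ θ ∈ P.feas, ∃ y ∈ P.plans, r < P.planLoss θ y.1 y.2) :
    ∃ y ∈ P.plans, ∀ θ ∈ P.feas, r ≤ P.planLoss θ y.1 y.2 := by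
  classical
  obtain ⟨Q, hQ, hcpt⟩ := hcpt
  obtain ⟨θ₁, hθ₁, hlt⟩ := hfin
  obtain ⟨ρ, hrρ, hρ⟩ : ∃ ρ : ℝ, r ≤ ρ ∧ P.worstCase θ₁ ≤ ρ :=
    ⟨max r (P.worstCase θ₁).toReal, le_max_left _ _, (EReal.le_coe_toReal hlt.ne).trans
      (EReal.coe_le_coe_iff.2 (le_max_right _ _))⟩
  have hW : ∀ θ, expect Q (P.loss θ) ≤ P.worstCase θ := fun θ =>
    le_iSup₂ (f := fun Q (_ : Q ∈ P.ball) => expect Q (P.loss θ)) Q hQ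
  obtain ⟨R, hR⟩ := (hcpt ρ).isBounded.subset_ball 0
  have hR₁ : ‖θ₁‖ < R := by simpa using hR ⟨hθ₁, (hW θ₁).trans hρ⟩
  have hopen : ∀ (s : ℝ) (y : P.plans), IsOpen {θ | s < P.planLoss θ y.1.1 y.1.2} := fun s y =>
    isOpen_lt continuous_const (continuous_planLoss hconv _ _)
  obtain ⟨F₁, hF₁⟩ := ((isCompact_sphere (0 : Vec m) R).inter_left
    (isClosed_feas hconv)).elim_finite_subcover _ (hopen ρ) (by
      rintro θ ⟨hθ, hθR⟩
      by_contra hno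
      simp only [mem_iUnion, mem_ofPred_eq, not_exists, not_lt] at hno
      have := hR ⟨hθ, (hW θ).trans (worstCase_le_of_planLoss_le heps hcost href hconv
        fun y hy => hno ⟨y, hy⟩)⟩
      simp only [mem_ball_zero_iff, mem_sphere_zero_iff_norm] at this hθR
      linarith)
  obtain ⟨F₂, hF₂⟩ := ((isCompact_closedBall (0 : Vec m) R).inter_left
    (isClosed_feas hconv)).elim_finite_subcover _ (hopen r) (by
      rintro θ ⟨hθ, -⟩
      obtain ⟨y, hy, hr⟩ := H θ hθ
      exact mem_iUnion.2 ⟨⟨y, hy⟩, hr⟩)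
  refine exists_plan_of_finset hconv href ⟨θ₁, hθ₁⟩ (F₁ ∪ F₂) fun θ hθ => ?_
  rcases le_or_gt ‖θ‖ R with hle | hgt
  · have := hF₂ ⟨hθ, by simpa using hle⟩
    simp only [mem_iUnion, mem_ofPred_eq] at this
    obtain ⟨y, hy, hr⟩ := this
    exact ⟨y, Finset.mem_union_right _ hy, hr.le⟩
  -- The segment from `θ₁` to `θ` meets the sphere, where some plan loses more than `ρ`. It loses at
  -- most `ρ` at `θ₁`, so by convexity it loses more than `ρ` at `θ`.
  · obtain ⟨s, hs, hsR⟩ : ∃ s ∈ Icc (0 : ℝ) 1, ‖(1 - s) • θ₁ + s • θ‖ = R := by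
      have h1 := intermediate_value_Icc (zero_le_one (α := ℝ))
        (f := fun s : ℝ => ‖(1 - s) • θ₁ + s • θ‖) (by fun_prop)
      exact h1 ⟨by simpa using hR₁.le, by simpa using hgt.le⟩
    have hmem : (1 - s) • θ₁ + s • θ ∈ P.feas :=
      convex_feas hconv hθ₁ hθ (by linarith [hs.2]) hs.1 (by ring)
    have h1 := hF₁ ⟨hmem, by simpa using hsR⟩
    simp only [mem_iUnion, mem_ofPred_eq] at h1
    obtain ⟨y, hy, hρy⟩ := h1
    refine ⟨y, Finset.mem_union_left _ hy, hrρ.trans ?_⟩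
    have h2 := (convexOn_planLoss hconv (z := y.1.2) y.2.1.nonneg).2 (mem_univ θ₁) (mem_univ θ)
      (sub_nonneg.2 hs.2) hs.1 (sub_add_cancel 1 s)
    have h3 : P.planLoss θ₁ y.1.1 y.1.2 ≤ ρ := EReal.coe_le_coe_iff.1
      ((planLoss_le_worstCase hconv href y.2 θ₁).trans hρ)
    simp only [smul_eq_mul] at h2
    have hs0 : 0 < s := by
      rcases hs.1.eq_or_lt with rfl | h0
      · simp at hsR; linarith
      · exact h0
    by_contra! hlt'
    nlinarith [mul_le_mul_of_nonneg_left h3 (by linarith [hs.2] : 0 ≤ 1 - s)]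

/-- Plans within the budget can move little mass far away. -/
theorem exists_mass_norm_bound (heps : 0 < P.eps) (href : P.DiscreteReference)
    (hreg : IsCompact P.supp ∨ P.SuperlinearCost) (j : Fin J) {δ : ℝ} (hδ : 0 < δ) :
    ∃ M : ℝ, 0 ≤ M ∧ ∀ y ∈ P.plans, ∀ i, y.1 i j * ‖y.2 i j‖ ≤ y.1 i j * M + δ := by
  -- The slope `δ / eps` is chosen so that, after multiplication by the mass, the budget `eps`
  -- bounds the cost term by `δ`.
  obtain ⟨M, hM, h⟩ : ∃ M : ℝ, 0 ≤ M ∧ ∀ z ∈ P.supp, P.cost z (P.atom j) < ⊤ →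
      ‖z‖ ≤ M + δ / P.eps * (P.cost z (P.atom j)).toReal := by
    have hpos : 0 < δ / P.eps := div_pos hδ heps
    rcases hreg with hc | hc
    · obtain ⟨M, hM⟩ := hc.isBounded.exists_norm_le
      refine ⟨max M 0, le_max_right _ _, fun z hz _ => ?_⟩
      have h1 := mul_nonneg hpos.le (ENNReal.toReal_nonneg (a := P.cost z (P.atom j)))
      linarith [hM z hz, le_max_left M 0]
    · have h1 := (hc _ (href.2.2 j)).eventually
        (lt_mem_nhds (ENNReal.ofReal_lt_top (r := (δ / P.eps)⁻¹)))
      rw [eventually_inf_principal] at h1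
      obtain ⟨M, -, hM⟩ := (Filter.hasBasis_cobounded_norm).eventually_iff.1 h1
      refine ⟨max M 1, zero_le_one.trans (le_max_right _ _), fun z hz hfin => ?_⟩
      have h0 := mul_nonneg hpos.le (ENNReal.toReal_nonneg (a := P.cost z (P.atom j)))
      rcases le_or_gt ‖z‖ (max M 1) with hle | hgt
      · linarith
      · have hz0 : 0 < ‖z‖ := zero_lt_one.trans_le ((le_max_right _ _).trans hgt.le)
        have h2 := hM (x := z) ((le_max_left M 1).trans hgt.le) hz
        rw [ENNReal.lt_div_iff_mul_lt (Or.inl (by simpa using hz0)) (Or.inl ENNReal.ofReal_ne_top),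
          ← ENNReal.ofReal_mul (inv_nonneg.2 hpos.le),
          ENNReal.ofReal_lt_iff_lt_toReal (by positivity) hfin.ne, inv_mul_lt_iff₀ hpos] at h2
        linarith [le_max_right M 1]
  refine ⟨M, hM, fun y hy i => ?_⟩
  rcases (hy.1.nonneg i j).eq_or_lt with h0 | h0
  · rw [← h0]; simpa using hδ.le
  have h1 : ENNReal.ofReal (y.1 i j) * P.cost (y.2 i j) (P.atom j) ≤ ENNReal.ofReal P.eps := by
    refine le_trans ?_ hy.2
    refine (Finset.single_le_sum (f := fun j => ENNReal.ofReal (y.1 i j) *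
      P.cost (y.2 i j) (P.atom j)) (fun _ _ => zero_le) (Finset.mem_univ j)).trans ?_
    exact Finset.single_le_sum (f := fun i => ∑ j, ENNReal.ofReal (y.1 i j) *
      P.cost (y.2 i j) (P.atom j)) (fun _ _ => zero_le) (Finset.mem_univ i)
  have hfin : P.cost (y.2 i j) (P.atom j) < ⊤ := by
    by_contra htop
    rw [not_lt_top_iff.1 htop, ENNReal.mul_top (by simpa using h0)] at h1
    exact absurd h1 (not_le.2 ENNReal.ofReal_lt_top)
  have h2 := ENNReal.toReal_mono ENNReal.ofReal_ne_top h1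
  rw [ENNReal.toReal_mul, ENNReal.toReal_ofReal h0.le, ENNReal.toReal_ofReal heps.le] at h2
  have h3 := mul_le_mul_of_nonneg_left (h _ (hy.1.mem i j) hfin) h0.le
  have h4 : δ / P.eps * (y.1 i j * (P.cost (y.2 i j) (P.atom j)).toReal) ≤ δ / P.eps * P.eps :=
    mul_le_mul_of_nonneg_left h2 (div_pos hδ heps).le
  rw [div_mul_cancel₀ _ heps.ne'] at h4
  linarith

theorem exists_piece_le (hconv : P.ConvexityConditions) (i : Fin I) (θ : Vec m) :
    ∃ (η : Vec d) (a : ℝ), ∀ z, P.piece i θ z ≤ a + ⟪η, z⟫ := by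
  obtain ⟨η, hη⟩ := exists_subgradient (hconv.piece_concave i θ).neg (x₀ := 0)
    ⟨mem_univ _, fun x _ => ⟨1, one_pos, mem_univ _⟩⟩
  refine ⟨-η, P.piece i θ 0, fun z => ?_⟩
  have := hη z (mem_univ z)
  simp only [Pi.neg_apply, sub_zero] at this
  rw [inner_neg_left]
  linarith

/-- Plans defeating finite sets of decisions are followed along an ultrafilter on these sets, which
eventually contain any given decision. Where the limit mass is positive, destinations stay bounded
and converge. Where it vanishes, mass times norm tends to zero, so affine majorants of the pieces
show that no loss survives. -/
theorem exists_plan_of_tight [NeZero I] (heps : 0 < P.eps) (hcost : P.CostIndiscernible)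
    (href : P.DiscreteReference) (hconv : P.ConvexityConditions)
    (hreg : IsCompact P.supp ∨ P.SuperlinearCost) {r : ℝ}
    (H : ∀ θ ∈ P.feas, ∃ y ∈ P.plans, r < P.planLoss θ y.1 y.2) :
    ∃ y ∈ P.plans, ∀ θ ∈ P.feas, r ≤ P.planLoss θ y.1 y.2 := by
  classical
  choose y hy hyr using exists_plan_of_finset_feas hconv href
    ⟨_, selMass_atom_mem_plans hcost href fun _ => 0⟩ H
  let U : Ultrafilter (Finset P.feas) := Ultrafilter.of atTop
  have hU : (U : Filter (Finset P.feas)) ≤ atTop := Ultrafilter.of_le _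
  have lim : ∀ {X : Type} [TopologicalSpace X] {s : Set X} (g : Finset P.feas → X), IsCompact s →
      (∀ᶠ t in U, g t ∈ s) → ∃ x ∈ s, Tendsto g U (𝓝 x) := by
    intro X _ s g hs hg
    exact isCompact_iff_ultrafilter_le_nhds.1 hs (U.map g) (le_principal_iff.2 hg)
  have hq : ∀ i j, ∃ q ∈ Icc 0 (P.prob j), Tendsto (fun t => (y t).1 i j) U (𝓝 q) := by
    intro i j
    refine lim _ isCompact_Icc (Eventually.of_forall fun t => ⟨(hy t).1.nonneg i j, ?_⟩)
    rw [← (hy t).1.mass j]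
    exact Finset.single_le_sum (f := fun i => (y t).1 i j) (fun i _ => (hy t).1.nonneg i j)
      (Finset.mem_univ i)
  choose q hq0 hqlim using hq
  -- If the mass vanishes in the limit, the destination may diverge; it is reset to the atom, at
  -- zero cost.
  let z' : Finset P.feas → Fin I → Fin J → Vec d := fun t i j =>
    if q i j = 0 then P.atom j else (y t).2 i j
  have hz' : ∀ t i j, z' t i j ∈ P.supp := by
    intro t i j
    simp only [z']
    split_ifs
    exacts [href.2.2 j, (hy t).1.mem i j]
  have hz : ∀ i j, ∃ z, Tendsto (fun t => z' t i j) U (𝓝 z) := by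
    intro i j
    by_cases h0 : q i j = 0
    · exact ⟨P.atom j, by simp only [z', h0, if_true]; exact tendsto_const_nhds⟩
    · have hpos : 0 < q i j := lt_of_le_of_ne (hq0 i j).1 (Ne.symm h0)
      obtain ⟨M, hM, hb⟩ := exists_mass_norm_bound heps href hreg j one_pos
      -- Eventually the mass exceeds half its limit, so the excess `1` in the mass bound costs at
      -- most `2 / q i j` in norm.
      obtain ⟨z, -, hz⟩ := lim (fun t => z' t i j) (isCompact_closedBall 0 (M + 2 / q i j)) (by
        filter_upwards [(hqlim i j).eventually (lt_mem_nhds (half_lt_self hpos))] with t ht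
        simp only [z', h0, if_false, mem_closedBall_zero_iff]
        have h1 := hb _ (hy t) i
        have h2 : 0 < (y t).1 i j := (half_pos hpos).trans ht
        have h3 : 1 ≤ (y t).1 i j * (2 / q i j) := by
          rw [mul_div_assoc', le_div_iff₀ hpos]; linarith
        refine le_of_mul_le_mul_left ?_ h2
        linarith)
      exact ⟨z, hz⟩
  choose z hzlim using hz
  refine ⟨(q, z), ⟨⟨fun i j => (hq0 i j).1, fun j => ?_, fun i j => ?_⟩, ?_⟩, fun θ hθ => ?_⟩
  · refine tendsto_nhds_unique (tendsto_finsetSum _ fun i _ => hqlim i j) ?_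
    simp only [(hy _).1.mass j]
    exact tendsto_const_nhds
  · exact (isClosed_supp hconv).mem_of_tendsto (hzlim i j) (Eventually.of_forall fun t => hz' t i j)
  -- Lower semicontinuity gives only an inequality with the limit `C`. That `C` is `0` where the
  -- mass vanishes keeps `0 * ∞` out of the limit of products.
  · have hc : ∀ i j, ∃ C : ENNReal, P.cost (z i j) (P.atom j) ≤ C ∧ (q i j = 0 → C = 0) ∧
        Tendsto (fun t => P.cost (z' t i j) (P.atom j)) U (𝓝 C) := by
      intro i j
      obtain ⟨C, -, hC⟩ := lim (fun t => P.cost (z' t i j) (P.atom j)) isCompact_univ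
        (Eventually.of_forall fun _ => mem_univ _)
      refine ⟨C, le_of_forall_lt fun a ha => ?_, fun h0 => ?_, hC⟩
      · obtain ⟨b, hab, hb⟩ := exists_between ha
        have h1 : Tendsto (fun t => (z' t i j, P.atom j)) U (𝓝 (z i j, P.atom j)) :=
          (hzlim i j).prodMk_nhds tendsto_const_nhds
        have h2 := h1.eventually (hconv.cost_lsc _ _ hb)
        exact hab.trans_le (ge_of_tendsto hC (h2.mono fun t ht => ht.le))
      · refine tendsto_nhds_unique hC ?_
        simp only [z', h0, if_true, cost_atom hcost href]
        exact tendsto_const_nhds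
    choose C hCle hC0 hC using hc
    have h1 : P.planCost q z ≤ ∑ i, ∑ j, ENNReal.ofReal (q i j) * C i j :=
      Finset.sum_le_sum fun i _ => Finset.sum_le_sum fun j _ => mul_le_mul_right (hCle i j) _
    refine h1.trans (le_of_tendsto (tendsto_finsetSum _ fun i _ => tendsto_finsetSum _ fun j _ =>
      ENNReal.Tendsto.mul (ENNReal.tendsto_ofReal (hqlim i j)) ?_ (hC i j)
        (Or.inr ENNReal.ofReal_ne_top)) (Eventually.of_forall fun t => le_trans ?_ (hy t).2))
    · by_cases h0 : q i j = 0
      · right; rw [hC0 i j h0]; simp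
      · left
        simpa using lt_of_le_of_ne (hq0 i j).1 (Ne.symm h0)
    · refine Finset.sum_le_sum fun i _ => Finset.sum_le_sum fun j _ => ?_
      simp only [z']
      split_ifs
      · rw [cost_atom hcost href]; simp
      · exact le_rfl
  · have hg : ∀ i j, ∃ g : Finset P.feas → ℝ, (∀ t, (y t).1 i j * P.piece i θ ((y t).2 i j) ≤ g t) ∧
        Tendsto g U (𝓝 (q i j * P.piece i θ (z i j))) := by
      intro i j
      by_cases h0 : q i j = 0
      · obtain ⟨η, a, hηa⟩ := exists_piece_le hconv i θ
        refine ⟨fun t => (y t).1 i j * a + ‖η‖ * ((y t).1 i j * ‖(y t).2 i j‖), fun t => ?_, ?_⟩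
        · have h1 := mul_le_mul_of_nonneg_left ((hηa ((y t).2 i j)).trans
            (add_le_add_right (real_inner_le_norm _ _) a)) ((hy t).1.nonneg i j)
          linarith
        · have hlim0 := hqlim i j
          rw [h0] at hlim0
          have h1 : Tendsto (fun t => (y t).1 i j * ‖(y t).2 i j‖) U (𝓝 0) := by
            refine tendsto_order.2 ⟨fun a ha => Eventually.of_forall fun t =>
              ha.trans_le (mul_nonneg ((hy t).1.nonneg i j) (norm_nonneg _)), fun a ha => ?_⟩
            obtain ⟨M, hM, hb⟩ := exists_mass_norm_bound heps href hreg j (half_pos ha)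
            have h2 : Tendsto (fun t => (y t).1 i j * M) U (𝓝 0) := by
              simpa using hlim0.mul_const M
            filter_upwards [h2.eventually (gt_mem_nhds (half_pos ha))] with t ht
            linarith [hb _ (hy t) i]
          rw [h0, zero_mul]
          simpa using (hlim0.mul_const a).add (h1.const_mul ‖η‖)
      · refine ⟨fun t => (y t).1 i j * P.piece i θ ((y t).2 i j), fun t => le_rfl, ?_⟩
        have h1 := hzlim i j
        simp only [z', h0, if_false] at h1
        exact (hqlim i j).mul (((continuous_piece_right hconv i θ).tendsto _).comp h1)
    choose g hg hglim using hg
    refine ge_of_tendsto (tendsto_finsetSum _ fun i _ => tendsto_finsetSum _ fun j _ => hglim i j)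
      ?_
    have hev : ∀ᶠ t in (U : Filter (Finset P.feas)), {⟨θ, hθ⟩} ≤ t := hU (eventually_ge_atTop _)
    filter_upwards [hev] with t ht
    exact (hyr t ⟨θ, hθ⟩ (ht (Finset.mem_singleton_self _))).trans
      (Finset.sum_le_sum fun i _ => Finset.sum_le_sum fun j _ => hg i j t)

/-- The minimax theorem for decisions and plans. -/
theorem exists_plan_of_lt_primalValue [NeZero I] (heps : 0 < P.eps) (hcost : P.CostIndiscernible)
    (href : P.DiscreteReference) (hconv : P.ConvexityConditions) (hfin : P.WorstCaseFinite)
    (hreg : P.RegularityCondition) {r : ℝ} (hr : (r : EReal) < P.primalValue) :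
    ∃ y ∈ P.plans, ∀ θ ∈ P.feas, r ≤ P.planLoss θ y.1 y.2 := by
  have H : ∀ θ ∈ P.feas, ∃ y ∈ P.plans, r < P.planLoss θ y.1 y.2 := by
    intro θ hθ
    by_contra! hno
    exact absurd ((iInf₂_le (f := fun θ (_ : θ ∈ P.feas) => P.worstCase θ) θ hθ).trans
      (worstCase_le_of_planLoss_le heps hcost href hconv hno)) (not_le.2 hr)
  rcases hreg with h | h
  · exact exists_plan_of_infCompact heps hcost href hconv hfin h H
  · exact exists_plan_of_tight heps hcost href hconv h H

end Problem

theorem ereal_coe_ennreal_sum {N : Type*} (s : Finset N) (g : N → ENNReal) :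
    ((∑ n ∈ s, g n : ENNReal) : EReal) = ∑ n ∈ s, (g n : EReal) := by
  classical
  induction s using Finset.induction_on with
  | empty => simp
  | insert n s hn ih => rw [Finset.sum_insert hn, Finset.sum_insert hn, EReal.coe_ennreal_add, ih]

theorem supportFun_zero_le {V : Type*} [NormedAddCommGroup V] [InnerProductSpace ℝ V] (C : Set V) :
    supportFun C 0 ≤ 0 :=
  iSup₂_le fun y _ => by simp

namespace Problem

variable {m d I J K L : ℕ} {P : Problem m d I J K L}

/-! The finite primal program. -/

theorem bot_lt_atomCost (j : Fin J) (z : Vec d) : ⊥ < P.atomCost j z :=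
  EReal.bot_lt_zero.trans_le (EReal.coe_ennreal_nonneg _)

theorem atomCost_eq_coe {j : Fin J} {z : Vec d} (h : P.cost z (P.atom j) < ⊤) :
    P.atomCost j z = ((P.cost z (P.atom j)).toReal : EReal) := by
  unfold atomCost
  lift P.cost z (P.atom j) to NNReal using h.ne with c
  rfl

/-- The Fenchel–Young inequalities for the loss, the cost and the constraints are added; `balance`
cancels the linear terms. -/
theorem PrimalFeasible.piece_le {x : PrimalVars m d I J K}
    (hx : P.PrimalFeasible x) (i : Fin I) (j : Fin J) {z : Vec d} (hz : z ∈ P.supp)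
    (hc : P.cost z (P.atom j) < ⊤) :
    P.piece i x.θ z ≤ x.s j + x.lam * (P.cost z (P.atom j)).toReal := by
  have h1 : ((⟪x.ζl i j, z⟫ - -P.piece i x.θ z : ℝ) : EReal)
      ≤ conj (fun z => ((-P.piece i x.θ z : ℝ) : EReal)) (x.ζl i j) :=
    le_conj (fun z => ((-P.piece i x.θ z : ℝ) : EReal)) _ z
  have h2 := le_persp_conj (atomCost_eq_coe hc).le (x.ζc i j) hx.lam_nonneg
  have h3 : ∀ k, ((⟪x.ζf i j k, z⟫ : ℝ) : EReal) ≤ persp (conj (P.f k)) (x.ζf i j k) (x.τ i j k) := by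
    intro k
    have := le_persp_conj (r := 0) (by simpa using hz k) (x.ζf i j k) (hx.τ_nonneg i j k)
    simpa using this
  have h4 := (add_le_add (add_le_add h1 h2) (Finset.sum_le_sum fun k (_ : k ∈ Finset.univ) => h3 k)).trans
    (hx.epi i j)
  rw [← ereal_coe_sum, ← EReal.coe_add, ← EReal.coe_add, EReal.coe_le_coe_iff] at h4
  have h5 : ⟪x.ζl i j, z⟫ + ⟪x.ζc i j, z⟫ + ∑ k, ⟪x.ζf i j k, z⟫ = 0 := by
    rw [← sum_inner, ← inner_add_left, ← inner_add_left, hx.balance, inner_zero_left]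
  linarith

theorem PrimalFeasible.worstCase_le [NeZero I] (heps : 0 < P.eps) (href : P.DiscreteReference)
    (hconv : P.ConvexityConditions) {x : PrimalVars m d I J K} (hx : P.PrimalFeasible x) :
    P.worstCase x.θ ≤ (P.primalObj x : EReal) :=
  worstCase_le_of_multiplier heps hconv href hx.lam_nonneg fun i j _ hz hc =>
    hx.piece_le i j hz hc

theorem exists_primalFeasible [NeZero I] (heps : 0 < P.eps) (hcost : P.CostIndiscernible)
    (href : P.DiscreteReference) (hconv : P.ConvexityConditions) (hslater : P.SlaterConditions)
    {θ : Vec m} (hθ : θ ∈ P.feas) {v : ℝ} (hv : ∀ y ∈ P.plans, P.planLoss θ y.1 y.2 ≤ v) {δ : ℝ}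
    (hδ : 0 < δ) : ∃ x, P.PrimalFeasible x ∧ x.θ = θ ∧ P.primalObj x ≤ v + δ := by
  obtain ⟨lam, s, hlam, hle, hs⟩ := exists_multiplier_of_planLoss_le heps hcost href hconv hv
  -- A positive multiplier keeps the domain of the scaled cost equal to that of the cost, whereas `0
  -- * ⊤ = 0` would enlarge it. The increase adds exactly `δ` to the objective.
  have ht : 0 < lam + δ / P.eps := add_pos_of_nonneg_of_pos hlam (div_pos hδ heps)
  have hex : ∀ i j, ∃ (τ : Fin K → ℝ) (ζl ζc : Vec d) (ζf : Fin K → Vec d), (∀ k, 0 ≤ τ k) ∧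
      conj (fun z => ((-P.piece i θ z : ℝ) : EReal)) ζl
        + persp (conj (P.atomCost j)) ζc (lam + δ / P.eps)
        + ∑ k, persp (conj (P.f k)) (ζf k) (τ k) ≤ (s j : EReal) ∧ ζl + ζc + ∑ k, ζf k = 0 := by
    intro i j
    have hdom : dom (fun z => ((lam + δ / P.eps : ℝ) : EReal) * P.atomCost j z)
        = dom (P.atomCost j) := by
      ext z
      by_cases hz : P.cost z (P.atom j) < ⊤
      · simp only [dom, mem_ofPred_eq, atomCost_eq_coe hz, ← EReal.coe_mul, EReal.coe_lt_top]
      · simp only [dom, mem_ofPred_eq, atomCost, not_lt_top_iff.1 hz, EReal.coe_ennreal_top,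
          EReal.coe_mul_top_of_pos ht]
    obtain ⟨τ, y, ζ, b, b', hτ, hsum, hb, hb', hbs⟩ := exists_dual_solution
      (u := ![fun z => ((-P.piece i θ z : ℝ) : EReal),
        fun z => ((lam + δ / P.eps : ℝ) : EReal) * P.atomCost j z]) (f := P.f) (x₀ := P.atom j)
      (v := -s j)
      (by
        intro n x
        fin_cases n
        · exact EReal.bot_lt_coe _
        · exact EReal.bot_lt_zero.trans_le
            (mul_nonneg (by exact_mod_cast ht.le) (EReal.coe_ennreal_nonneg _)))
      (fun k => (hconv.supp_fun k).1.1)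
      (by
        intro n
        fin_cases n
        · exact isConvexFun_coe (hconv.piece_concave i θ).neg
        · exact (hconv.cost_convex _ (href.2.2 j)).const_mul ht)
      (fun k => (hconv.supp_fun k).2.1)
      (by
        intro n
        fin_cases n
        · exact algRelInt_dom_coe _ _
        · have := algRelInt_of_mem_intrinsicInterior (hslater.1 j).1
          rw [← hdom] at this
          exact this)
      (hslater.1 j).2
      (by
        intro z hz
        rw [Fin.sum_univ_two]
        simp only [Matrix.cons_val_zero, Matrix.cons_val_one]
        by_cases hc : P.cost z (P.atom j) < ⊤
        · rw [atomCost_eq_coe hc, ← EReal.coe_mul, ← EReal.coe_add, EReal.coe_le_coe_iff, add_mul]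
          have h1 := hs i j z hz hc
          have h2 : 0 ≤ δ / P.eps * (P.cost z (P.atom j)).toReal :=
            mul_nonneg (div_pos hδ heps).le ENNReal.toReal_nonneg
          linarith
        · rw [atomCost, not_lt_top_iff.1 hc, EReal.coe_ennreal_top, EReal.coe_mul_top_of_pos ht,
            EReal.coe_add_top]
          exact le_top)
    rw [Fin.sum_univ_two] at hsum hbs
    refine ⟨τ, y 0, y 1, ζ, hτ, ?_, hsum⟩
    calc _ ≤ (b 0 : EReal) + (b 1 : EReal) + ∑ k, (b' k : EReal) :=
          add_le_add (add_le_add (hb 0) (persp_conj_le_of_conj_mul_le (bot_lt_atomCost j) ht (hb 1)))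
            (Finset.sum_le_sum fun k _ => hb' k)
      _ = ((b 0 + b 1 + ∑ k, b' k : ℝ) : EReal) := by
          rw [EReal.coe_add, EReal.coe_add, ereal_coe_sum]
      _ ≤ _ := EReal.coe_le_coe_iff.2 (by linarith)
  choose τ ζl ζc ζf hτ hepi hbal using hex
  refine ⟨⟨θ, lam + δ / P.eps, s, ζl, ζc, τ, ζf⟩, ⟨hθ, ht.le, hτ, hepi, hbal⟩, rfl, ?_⟩
  simp only [primalObj, add_mul, div_mul_cancel₀ _ heps.ne']
  linarith

theorem SolvesPrimalProgram.solvesPrimalDRO [NeZero I] (heps : 0 < P.eps)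
    (hcost : P.CostIndiscernible) (href : P.DiscreteReference) (hconv : P.ConvexityConditions)
    (hslater : P.SlaterConditions) {x : PrimalVars m d I J K} (hx : P.SolvesPrimalProgram x) :
    P.SolvesPrimalDRO x.θ := by
  refine ⟨hx.1.θ_mem, fun θ hθ => (hx.1.worstCase_le heps href hconv).trans ?_⟩
  by_cases htop : P.worstCase θ = ⊤
  · rw [htop]; exact le_top
  have hbot : P.worstCase θ ≠ ⊥ := ne_of_gt ((EReal.bot_lt_coe _).trans_le
    (planLoss_le_worstCase hconv href (selMass_atom_mem_plans hcost href fun _ => 0) θ))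
  lift P.worstCase θ to ℝ using ⟨htop, hbot⟩ with v hv
  refine EReal.coe_le_coe_iff.2 (le_of_forall_pos_le_add fun δ hδ => ?_)
  obtain ⟨x', hx', -, hle⟩ := exists_primalFeasible heps hcost href hconv hslater hθ (v := v)
    (fun y hy => EReal.coe_le_coe_iff.1 (hv ▸ planLoss_le_worstCase hconv href hy θ)) hδ
  exact (hx.2 x' hx').trans hle

/-! The finite dual program. -/

theorem conjPiece_smul (i : Fin I) (j : Fin J) (α : Vec m) (ξ : Vec d) (q : ℝ) :
    P.conjPiece i j (q⁻¹ • WithLp.toLp 2 (α, ξ))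
      = conj (fun θ => (P.piece i θ (P.atom j + q⁻¹ • ξ) : EReal)) (q⁻¹ • α) :=
  rfl

/-- A plan whose loss is bounded below over all decisions yields a point of the finite dual
program. -/
theorem exists_dualFeasible (heps : 0 < P.eps) (hconv : P.ConvexityConditions)
    (hslater : P.SlaterConditions) {y : (Fin I → Fin J → ℝ) × (Fin I → Fin J → Vec d)}
    (hy : y ∈ P.plans) {r : ℝ} (hr : ∀ θ ∈ P.feas, r ≤ P.planLoss θ y.1 y.2) :
    ∃ y', P.DualFeasible y' ∧ (r : EReal) ≤ P.dualObj y' := by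
  obtain ⟨q, z⟩ := y
  obtain ⟨hp, hc⟩ : P.IsPlan q z ∧ P.planCost q z ≤ ENNReal.ofReal P.eps := hy
  obtain ⟨θ₀, hθ₀⟩ := hslater.2
  obtain ⟨ν, α, β, b, b', hν, hsum, hb, hb', hbs⟩ := exists_dual_solution
    (u := fun (n : Fin I × Fin J) θ => ((q n.1 n.2 * P.piece n.1 θ (z n.1 n.2) : ℝ) : EReal))
    (f := P.g) (x₀ := θ₀) (v := r) (fun n x => EReal.bot_lt_coe _)
    (fun l => (hconv.feas_fun l).1.1)
    (fun n => isConvexFun_coe ((hconv.piece_convex _ _).smul (hp.nonneg _ _)))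
    (fun l => (hconv.feas_fun l).2.1) (fun n => algRelInt_dom_coe _ _) hθ₀ (by
      intro θ hθ
      rw [← ereal_coe_sum, EReal.coe_le_coe_iff, Fintype.sum_prod_type]
      exact hr θ hθ)
  have hz : ∀ i j, 0 < q i j → P.atom j + (q i j)⁻¹ • q i j • (z i j - P.atom j) = z i j := by
    intro i j h0
    rw [inv_smul_smul₀ h0.ne', add_sub_cancel]
  -- The direction is displacement times mass, so that `atom j + ξ / q` recovers the destination,
  -- and `ξ = 0` wherever `q = 0`.
  refine ⟨⟨q, fun i j => q i j • (z i j - P.atom j), fun i j => α (i, j), ν, β⟩,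
    ⟨hp.nonneg, hν, fun i j k => ?_, hp.mass, ?_, ?_⟩, ?_⟩
  · rcases (hp.nonneg i j).eq_or_lt with h0 | h0
    · simp only [← h0, zero_smul, persp, lt_irrefl, if_false]
      exact supportFun_zero_le _
    · simp only [persp, if_pos h0, hz i j h0]
      have h1 : (q i j : EReal) * P.f k (z i j) ≤ (q i j : EReal) * 0 := by
        gcongr
        exact hp.mem i j k
      simpa using h1
  · rw [Fintype.sum_prod_type] at hsum
    exact hsum
  · calc _ ≤ ∑ i, ∑ j, ((ENNReal.ofReal (q i j) * P.cost (z i j) (P.atom j) : ENNReal) : EReal) := by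
          refine Finset.sum_le_sum fun i _ => Finset.sum_le_sum fun j _ => ?_
          rcases (hp.nonneg i j).eq_or_lt with h0 | h0
          · simp only [← h0, zero_smul, persp, lt_irrefl, if_false]
            exact (supportFun_zero_le _).trans (EReal.coe_ennreal_nonneg _)
          · simp only [persp, if_pos h0, hz i j h0]
            rw [EReal.coe_ennreal_mul, EReal.coe_ennreal_ofReal, max_eq_left h0.le]
            exact le_rfl
      _ = ((P.planCost q z : ENNReal) : EReal) := by
          simp only [planCost, ereal_coe_ennreal_sum]
      _ ≤ ((ENNReal.ofReal P.eps : ENNReal) : EReal) := EReal.coe_ennreal_le_coe_ennreal_iff.2 hc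
      _ = P.eps := by rw [EReal.coe_ennreal_ofReal, max_eq_left heps.le]
  · have h1 : ∀ i j, persp (P.conjPiece i j)
        (WithLp.toLp 2 (α (i, j), q i j • (z i j - P.atom j))) (q i j) ≤ b (i, j) := by
      intro i j
      rcases (hp.nonneg i j).eq_or_lt with h0 | h0
      -- With no mass and no direction, the support function sees only the decision component. The
      -- conjugate of the zero function being at most `b` bounds `⟪α, θ⟫` for every `θ`.
      · simp only [← h0, zero_smul, persp, lt_irrefl, if_false]
        refine iSup₂_le fun w _ => ?_
        have h2 := (le_conj _ (α (i, j)) w.fst).trans (hb (i, j))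
        simp only [← h0, zero_mul, EReal.coe_zero, sub_zero] at h2
        rw [WithLp.prod_inner_apply]
        simp only [inner_zero_right, add_zero]
        rw [real_inner_comm]
        exact h2
      · have h2 := persp_conj_le_of_conj_mul_le (f := fun θ => (P.piece i θ (z i j) : EReal))
          (fun θ => EReal.bot_lt_coe _) h0 (ζ := α (i, j)) (b := b (i, j)) (by
            simp only [← EReal.coe_mul]
            exact hb (i, j))
        rw [persp, if_pos h0] at h2 ⊢
        rw [conjPiece_smul, hz i j h0]
        exact h2
    have h2 : ∑ i, ∑ j, persp (P.conjPiece i j)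
        (WithLp.toLp 2 (α (i, j), q i j • (z i j - P.atom j))) (q i j)
          ≤ ((∑ i, ∑ j, b (i, j) : ℝ) : EReal) := by
      simp only [ereal_coe_sum]
      exact Finset.sum_le_sum fun i _ => Finset.sum_le_sum fun j _ => h1 i j
    have h3 : ∑ l, persp (conj (P.g l)) (β l) (ν l) ≤ ((∑ l, b' l : ℝ) : EReal) := by
      rw [ereal_coe_sum]
      exact Finset.sum_le_sum fun l _ => hb' l
    refine le_trans ?_ (EReal.sub_le_sub (EReal.neg_le_neg_iff.2 h2) h3)
    rw [← EReal.coe_neg, ← EReal.coe_sub, EReal.coe_le_coe_iff]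
    rw [Fintype.sum_prod_type] at hbs
    linarith

/-- The destinations encoded by a point of the finite dual program. -/
noncomputable def dest (P : Problem m d I J K L) (y : DualVars m d I J L) (i : Fin I) (j : Fin J) :
    Vec d :=
  P.atom j + (y.q i j)⁻¹ • y.ξ i j

theorem discreteDist_eq_planDist {y : DualVars m d I J L} (hq : ∀ i j, 0 ≤ y.q i j) :
    P.discreteDist y = planDist y.q (P.dest y) := by
  rw [discreteDist, planDist, Finset.sum_comm]
  refine Finset.sum_congr rfl fun j _ => ?_
  rw [Finset.sum_filter]
  refine Finset.sum_congr rfl fun i _ => ?_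
  split_ifs with h0
  · rfl
  · rw [le_antisymm (not_lt.1 h0) (hq i j)]; simp

theorem ξ_eq_zero {y : DualVars m d I J L} (hinf : ∀ j, infIndices y j = ∅) {i : Fin I} {j : Fin J}
    (h0 : y.q i j = 0) : y.ξ i j = 0 := by
  by_contra hne
  have : i ∈ infIndices y j := ⟨h0, hne⟩
  rw [hinf j] at this
  exact this

theorem DualFeasible.dest_mem_plans (heps : 0 < P.eps) (href : P.DiscreteReference)
    {y : DualVars m d I J L} (hy : P.DualFeasible y) (hinf : ∀ j, infIndices y j = ∅) :
    (y.q, P.dest y) ∈ P.plans := by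
  refine ⟨⟨hy.q_nonneg, hy.mass, fun i j => ?_⟩, ?_⟩
  -- For zero mass, `0⁻¹ = 0` places the destination at the atom, which is in the support set.
  · rcases (hy.q_nonneg i j).eq_or_lt with h0 | h0
    · simp only [dest, ← h0, inv_zero, zero_smul, add_zero]
      exact href.2.2 j
    · intro k
      by_contra! hlt
      have h1 := hy.supp i j k
      rw [persp, if_pos h0] at h1
      exact absurd h1 (not_le.2 (EReal.mul_pos (by exact_mod_cast h0) hlt))
  · have h1 : ((P.planCost y.q (P.dest y) : ENNReal) : EReal)
        ≤ ((ENNReal.ofReal P.eps : ENNReal) : EReal) := by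
      rw [EReal.coe_ennreal_ofReal, max_eq_left heps.le]
      refine le_trans ?_ hy.budget
      simp only [planCost, ereal_coe_ennreal_sum]
      refine Finset.sum_le_sum fun i _ => Finset.sum_le_sum fun j _ => ?_
      rcases (hy.q_nonneg i j).eq_or_lt with h0 | h0
      · rw [ξ_eq_zero hinf h0.symm]
        simp only [← h0, persp, lt_irrefl, if_false, ENNReal.ofReal_zero, zero_mul,
          EReal.coe_ennreal_zero]
        -- A nonempty conjugate domain is needed: a support function over the empty set would be
        -- `⊥`. Nonnegativity of the cost puts `0` in it.
        have h2 : (0 : Vec d) ∈ dom (conj fun x => P.atomCost j (P.atom j + x)) := by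
          refine (conj_le_coe (b := 0) (fun x => bot_lt_atomCost j _) fun x _ => ?_).trans_lt
            (EReal.coe_lt_top _)
          rw [inner_zero_left, zero_sub, neg_nonpos]
          exact EReal.toReal_nonneg (EReal.coe_ennreal_nonneg _)
        refine le_trans ?_ (le_iSup₂ (f := fun (y : Vec d)
          (_ : y ∈ dom (conj fun x => P.atomCost j (P.atom j + x))) =>
            ((⟪y, (0 : Vec d)⟫ : ℝ) : EReal)) 0 h2)
        simp
      · rw [persp, if_pos h0, EReal.coe_ennreal_mul, EReal.coe_ennreal_ofReal, max_eq_left h0.le]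
        exact le_rfl
    exact EReal.coe_ennreal_le_coe_ennreal_iff.1 h1

/-- By Fenchel–Young in `θ`, the conjugate at `(θ, w)` is at most the supremum of `⟪w, ξ⟫ + ℓ_i(θ,
ẑ_j + ξ)` over `ξ`; the negative slope of an affine majorant of the piece makes this finite. -/
theorem exists_mem_dom_conj_conjPiece (hconv : P.ConvexityConditions) (i : Fin I) (j : Fin J)
    (θ : Vec m) : ∃ w : Vec d, WithLp.toLp 2 (θ, w) ∈ dom (conj (P.conjPiece i j)) := by
  obtain ⟨η, a, hη⟩ := exists_piece_le hconv i θ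
  refine ⟨-η, lt_of_le_of_lt (iSup_le fun v => ?_) (EReal.coe_lt_top (a + ⟪η, P.atom j⟫))⟩
  have h1 : ((⟪v.fst, θ⟫ - P.piece i θ (P.atom j + v.snd) : ℝ) : EReal) ≤ P.conjPiece i j v :=
    le_conj (fun θ => (P.piece i θ (P.atom j + v.snd) : EReal)) v.fst θ
  refine (EReal.sub_le_sub le_rfl h1).trans ?_
  rw [← EReal.coe_sub, EReal.coe_le_coe_iff, WithLp.prod_inner_apply]
  have h2 := hη (P.atom j + v.snd)
  have h3 : ⟪θ, v.fst⟫ = ⟪v.fst, θ⟫ := real_inner_comm _ _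
  rw [inner_add_right] at h2
  simp only [inner_neg_left]
  change ⟪θ, v.fst⟫ + -⟪η, v.snd⟫ - _ ≤ _
  linarith

/-- Fenchel–Young in the decision is summed over pieces and constraints, and `balance` cancels the
linear terms. A pair with `q = 0` has `ξ = 0`, but `α` may be nonzero; its term still dominates `⟪α,
θ⟫`, because `θ` occurs in the domain of the conjugate. -/
theorem DualFeasible.dualObj_le (hconv : P.ConvexityConditions)
    {y : DualVars m d I J L} (hy : P.DualFeasible y) (hinf : ∀ j, infIndices y j = ∅) {θ : Vec m}
    (hθ : θ ∈ P.feas) : P.dualObj y ≤ (P.planLoss θ y.q (P.dest y) : EReal) := by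
  have h1 : ∀ i j, ((⟪y.α i j, θ⟫ - y.q i j * P.piece i θ (P.dest y i j) : ℝ) : EReal)
      ≤ persp (P.conjPiece i j) (WithLp.toLp 2 (y.α i j, y.ξ i j)) (y.q i j) := by
    intro i j
    rcases (hy.q_nonneg i j).eq_or_lt with h0 | h0
    · rw [ξ_eq_zero hinf h0.symm]
      simp only [← h0, persp, lt_irrefl, if_false, zero_mul, sub_zero]
      obtain ⟨w, hw⟩ := exists_mem_dom_conj_conjPiece hconv i j θ
      refine le_trans (le_of_eq ?_) (le_iSup₂ (f := fun (v : WithLp 2 (Vec m × Vec d))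
        (_ : v ∈ dom (conj (P.conjPiece i j))) =>
          ((⟪v, WithLp.toLp 2 (y.α i j, (0 : Vec d))⟫ : ℝ) : EReal)) _ hw)
      rw [WithLp.prod_inner_apply]
      simp only [inner_zero_right, add_zero]
      rw [real_inner_comm]
    · have h2 := le_persp_conj (f := fun θ => (P.piece i θ (P.dest y i j) : EReal)) le_rfl
        (y.α i j) h0.le (x := θ)
      rw [persp, if_pos h0] at h2 ⊢
      rw [conjPiece_smul]
      exact h2
  have h2 : ∀ l, ((⟪y.β l, θ⟫ : ℝ) : EReal) ≤ persp (conj (P.g l)) (y.β l) (y.ν l) := by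
    intro l
    have := le_persp_conj (r := 0) (by simpa using hθ l) (y.β l) (hy.ν_nonneg l)
    simpa using this
  have h3 : ((∑ i, ∑ j, (⟪y.α i j, θ⟫ - y.q i j * P.piece i θ (P.dest y i j)) : ℝ) : EReal)
      ≤ ∑ i, ∑ j, persp (P.conjPiece i j) (WithLp.toLp 2 (y.α i j, y.ξ i j)) (y.q i j) := by
    simp only [ereal_coe_sum]
    exact Finset.sum_le_sum fun i _ => Finset.sum_le_sum fun j _ => h1 i j
  have h4 : ((∑ l, ⟪y.β l, θ⟫ : ℝ) : EReal) ≤ ∑ l, persp (conj (P.g l)) (y.β l) (y.ν l) := by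
    rw [ereal_coe_sum]
    exact Finset.sum_le_sum fun l _ => h2 l
  refine (EReal.sub_le_sub (EReal.neg_le_neg_iff.2 h3) h4).trans ?_
  rw [← EReal.coe_neg, ← EReal.coe_sub, EReal.coe_le_coe_iff]
  have h5 : ∑ i, ∑ j, ⟪y.α i j, θ⟫ + ∑ l, ⟪y.β l, θ⟫ = 0 := by
    simp only [← sum_inner]
    rw [← inner_add_left, hy.balance, inner_zero_left]
  simp only [Finset.sum_sub_distrib]
  unfold planLoss
  linarith

theorem bestCase_le_primalValue {Q : Measure (Vec d)} (hQ : Q ∈ P.ball) :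
    P.bestCase Q ≤ P.primalValue :=
  iInf₂_mono fun θ _ => le_iSup₂ (f := fun Q (_ : Q ∈ P.ball) => expect Q (P.loss θ)) Q hQ

theorem primalValue_eq_dualValue [NeZero I] (heps : 0 < P.eps) (hcost : P.CostIndiscernible)
    (hfin : P.WorstCaseFinite) (href : P.DiscreteReference) (hconv : P.ConvexityConditions)
    (hreg : P.RegularityCondition) : P.primalValue = P.dualValue := by
  refine le_antisymm (EReal.ge_of_forall_gt_iff_ge.1 fun r hr => ?_)
    (iSup₂_le fun Q hQ => bestCase_le_primalValue hQ)
  obtain ⟨y, hy, hle⟩ := exists_plan_of_lt_primalValue heps hcost href hconv hfin hreg hr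
  refine le_trans ?_ (le_iSup₂ (f := fun Q (_ : Q ∈ P.ball) => P.bestCase Q) _
    (planDist_mem_ball hconv href hy.1 hy.2))
  exact le_iInf₂ fun θ hθ =>
    (EReal.coe_le_coe_iff.2 (hle θ hθ)).trans (planLoss_le_expect hy.1.nonneg θ)

/-- Every `r` below the primal value is reached by a point of (FD), so the optimal objective is at
least the primal value. That objective is at most the best case of the extracted distribution, while
no distribution in the ball has a best case above the primal value. -/
theorem SolvesDualProgram.solvesDualDRO [NeZero I] (heps : 0 < P.eps) (hcost : P.CostIndiscernible)
    (hfin : P.WorstCaseFinite) (href : P.DiscreteReference) (hconv : P.ConvexityConditions)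
    (hslater : P.SlaterConditions) (hreg : P.RegularityCondition) {y : DualVars m d I J L}
    (hy : P.SolvesDualProgram y) (hinf : ∀ j, infIndices y j = ∅) :
    P.SolvesDualDRO (P.discreteDist y) := by
  have hplan := hy.1.dest_mem_plans heps href hinf
  rw [discreteDist_eq_planDist hy.1.q_nonneg]
  refine ⟨planDist_mem_ball hconv href hplan.1 hplan.2, fun Q hQ => ?_⟩
  refine (bestCase_le_primalValue hQ).trans (le_trans ?_ (le_iInf₂ fun θ hθ =>
    (hy.1.dualObj_le hconv hinf hθ).trans (planLoss_le_expect hy.1.q_nonneg θ)))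
  refine EReal.ge_of_forall_gt_iff_ge.1 fun r hr => ?_
  obtain ⟨w, hw, hle⟩ := exists_plan_of_lt_primalValue heps hcost href hconv hfin hreg hr
  obtain ⟨y', hy', hr'⟩ := exists_dualFeasible heps hconv hslater hw hle
  exact hr'.trans (hy.2 y' hy')

end Problem

end DRO

theorem theorem2p16 {m d I J K L : ℕ} [NeZero I] (P : DRO.Problem m d I J K L)
    (heps : 0 < P.eps)
    (hcost : P.CostIndiscernible)
    (hint : P.LossNegPartUnifInt)
    (hfin : P.WorstCaseFinite)
    (href : P.DiscreteReference)
    (hconv : P.ConvexityConditions)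
    (hslater : P.SlaterConditions)
    (hreg : P.RegularityCondition) :
    P.primalValue = P.dualValue ∧
    (∀ x : DRO.PrimalVars m d I J K, P.SolvesPrimalProgram x → P.SolvesPrimalDRO x.θ) ∧
    (∀ y : DRO.DualVars m d I J L, P.SolvesDualProgram y →
      (∀ j, DRO.Problem.infIndices y j = ∅) → P.SolvesDualDRO (P.discreteDist y)) :=
  ⟨DRO.Problem.primalValue_eq_dualValue heps hcost hfin href hconv hreg,
    fun _ hx => hx.solvesPrimalDRO heps hcost href hconv hslater,
    fun _ hy hinf => hy.solvesDualDRO heps hcost hfin href hconv hslater hreg hinf⟩
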